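/- Let \((r,\theta)\) be polar coordinates in \(\mathbb{R}^2\), \(\bm e_r=(\cos\theta,\sin\theta)\), \(\bm e_\theta=(-\sin\theta,\cos\theta)\), and write a vector field as \(\bm u=u_r\bm e_r+u_\theta\bm e_\theta\). Let \(0<\theta_0<2\pi\), \(\alpha\in\mathbb{R}\), \(\alpha\neq1\), and \(\Omega=\{(r,\theta):1<r<2,\ 0<\theta<\theta_0\}\). Let \(\bm u\in C^2(\overline\Omega)\), together with a pressure \(P\), solve the stationary Euler equations \(\bm u\cdot\nabla\bm u=-\nabla P\), \(\operatorname{div}\bm u=0\) in \(\Omega\), with \(|u_r|>0\) on \(\overline\Omega\). Suppose that for some constants \(c_1,c_2\) \[ u_\theta|_{\theta=0}=\frac{c_1}{r^\alpha},\qquad u_\theta|_{\theta=\theta_0}=\frac{c_2}{r^\alpha},\qquad \bm u|_{r=1}=2^\alpha\,\bm u|_{r=2},\qquad \partial_ru_\theta|_{r=1}=2^{\alpha+1}\,\partial_ru_\theta|_{r=2}, \] where \(\bm u|_{r=1}\) and \(\bm u|_{r=2}\) are compared at equal \(\theta\in[0,\theta_0]\). Then \(c_1\neq c_2\). Assume in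 addition that one of the following holds: (A1) \(c_1c_2>0\), and \(\partial_\theta(r^\alpha u_r)\) is constant along \(\theta=0\) or constant along \(\theta=\theta_0\); (A2) \(c_1=0\), \(\alpha>1\), and \(\partial_\theta(r^\alpha u_r)\) is constant along \(\theta=\theta_0\); (A3) \(c_2=0\), \(\alpha>1\), and \(\partial_\theta(r^\alpha u_r)\) is constant along \(\theta=0\); (A4) \(c_1c_2<0\), \(\alpha>1\), and \(\partial_\theta(r^\alpha u_r)\) is constant along \(\theta=0\) and constant along \(\theta=\theta_0\) (the two constants may differ). Then \(\bm u\) is \((-\alpha)\)-homogeneous, and there are \(v,f\in C^2([0,\theta_0])\) with \[ \bm u=\frac{v(\theta)}{r^\alpha}\bm e_\theta+\frac{f(\theta)}{r^\alpha}\bm e_r,\qquad (1-\alpha)f+v'=0\quad\text{on }[0,\theta_0]. \] If \(\alpha\neq0\), then \(P\) is \((-2\alpha)\)-homogeneous up to an additive constant: there are constants \(p,C\) such that \[ P=\frac{p}{r^{2\alpha}}+C\ \text{ in }\Omega,\qquad vf'=\alpha f^2+v^2+2\alpha p\ \text{ on }[0,\theta_0]. \] If \(\alpha=0\), there are constants \(\kappa,C\)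 such that \(P=\kappa\ln r+C\) in \(\Omega\) and \(vf'=v^2-\kappa\) on \([0,\theta_0]\). Moreover, \(v\) is strictly monotone on \([0,\theta_0]\); \(|v|>0\) on \((0,\theta_0)\) in cases (A1)–(A3); \(v\) takes both positive and negative values on \((0,\theta_0)\) in case (A4); and in all four cases \(f\) is strictly sign-definite on \([0,\theta_0]\), i.e. \(f>0\) on all of \([0,\theta_0]\) or \(f<0\) on all of \([0,\theta_0]\). -/

import Mathlib

open Real Set

noncomputable section

/-- The Euclidean plane. -/
abbrev Plane : Type := EuclideanSpace ℝ (Fin 2)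

/-- The radial unit vector `(cos θ, sin θ)`. -/
def eR (θ : ℝ) : Plane := !₂[cos θ, sin θ]

/-- The angular unit vector `(-sin θ, cos θ)`. -/
def eTheta (θ : ℝ) : Plane := !₂[-sin θ, cos θ]

/-- The point with polar coordinates `(r, θ)`. -/
def polarPt (r θ : ℝ) : Plane := r • eR θ

/-- The open truncated sector `a < r < b`, `0 < θ < θ₀`. -/
def sector (a b θ₀ : ℝ) : Set Plane :=
  {x | ∃ r θ : ℝ, a < r ∧ r < b ∧ 0 < θ ∧ θ < θ₀ ∧ x = polarPt r θ}

/-- The radial component of `u` at the point with polar coordinates `(r, θ)`. -/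
def radialComp (u : Plane → Plane) (r θ : ℝ) : ℝ := inner ℝ (u (polarPt r θ)) (eR θ)

/-- The angular component of `u` at the point with polar coordinates `(r, θ)`. -/
def angularComp (u : Plane → Plane) (r θ : ℝ) : ℝ := inner ℝ (u (polarPt r θ)) (eTheta θ)

/-- The divergence of a vector field in the plane. -/
def divergence (u : Plane → Plane) (x : Plane) : ℝ :=
  ∑ i : Fin 2, (fderiv ℝ u x (EuclideanSpace.single i 1)) i

/-- `(u, P)` is a classical solution in the open set `Ω` of the stationary incompressible Euler
equations `u · ∇u = -∇P`, `div u = 0`. -/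
structure IsEulerSolution (Ω : Set Plane) (u : Plane → Plane) (P : Plane → ℝ) : Prop where
  differentiable_velocity : ∀ x ∈ Ω, DifferentiableAt ℝ u x
  differentiable_pressure : ∀ x ∈ Ω, DifferentiableAt ℝ P x
  momentum : ∀ x ∈ Ω, fderiv ℝ u x (u x) = -gradient P x
  incompressible : ∀ x ∈ Ω, divergence u x = 0

/-- `F` is positively homogeneous of degree `β` on `s`. -/
def HomogeneousOn {E : Type*} [SMul ℝ E] (F : Plane → E) (β : ℝ) (s : Set Plane) : Prop :=
  ∀ x ∈ s, ∀ t : ℝ, 0 < t → t • x ∈ s → F (t • x) = t ^ β • F x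

/-- The boundary condition on the two straight edges `θ = 0` and `θ = θ₀`. -/
def EdgeCondition (α θ₀ c₁ c₂ : ℝ) (u : Plane → Plane) : Prop :=
  ∀ r ∈ Icc (1 : ℝ) 2,
    angularComp u r 0 = c₁ / r ^ α ∧ angularComp u r θ₀ = c₂ / r ^ α

/-- The boundary condition relating the two arcs `r = 1` and `r = 2`;
the radial derivatives there are one-sided, from inside `[1, 2]`. -/
def ArcCondition (α θ₀ : ℝ) (u : Plane → Plane) : Prop :=
  ∀ θ ∈ Icc (0 : ℝ) θ₀,
    u (polarPt 1 θ) = (2 : ℝ) ^ α • u (polarPt 2 θ) ∧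
    derivWithin (fun r => angularComp u r θ) (Icc 1 2) 1 =
      (2 : ℝ) ^ (α + 1) * derivWithin (fun r => angularComp u r θ) (Icc 1 2) 2

/-- `∂_θ (r ^ α u_r)` is constant along the edge `θ = φ`, where `φ` is `0` or `θ₀`;
the angular derivative is one-sided, from inside `[0, θ₀]`. -/
def ConstAngularDerivOnEdge (α θ₀ : ℝ) (u : Plane → Plane) (φ : ℝ) : Prop :=
  ∃ c : ℝ, ∀ r ∈ Icc (1 : ℝ) 2,
    derivWithin (fun θ => r ^ α * radialComp u r θ) (Icc 0 θ₀) φ = c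

def CondA1 (α θ₀ c₁ c₂ : ℝ) (u : Plane → Plane) : Prop :=
  0 < c₁ * c₂ ∧
    (ConstAngularDerivOnEdge α θ₀ u 0 ∨ ConstAngularDerivOnEdge α θ₀ u θ₀)

def CondA2 (α θ₀ c₁ : ℝ) (u : Plane → Plane) : Prop :=
  c₁ = 0 ∧ 1 < α ∧ ConstAngularDerivOnEdge α θ₀ u θ₀

def CondA3 (α θ₀ c₂ : ℝ) (u : Plane → Plane) : Prop :=
  c₂ = 0 ∧ 1 < α ∧ ConstAngularDerivOnEdge α θ₀ u 0

def CondA4 (α θ₀ c₁ c₂ : ℝ) (u : Plane → Plane) : Prop :=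
  c₁ * c₂ < 0 ∧ 1 < α ∧
    ConstAngularDerivOnEdge α θ₀ u 0 ∧ ConstAngularDerivOnEdge α θ₀ u θ₀

end

/-! Put `s = log r`, `t = θ`, `g = r^α u_r`, `h = r^α u_θ`. The equations for `g` and `h` then have
coefficients independent of `s`, the arc conditions become periodicity in `s`, and homogeneity of
the flow means independence of `s`.

The divergence equation is the closedness of a 1-form whose rescaled potential `ψ` satisfies `ψ_t =
g` and `ψ_s = -h - (1-α)ψ`. As `α ≠ 1`, a suitable additive constant in the potential makes `ψ`
periodic, with the values `-c₁/(1-α)` and `-c₂/(1-α)` on the edges. Since `g` has no zero, `ψ` is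
strictly monotone in `t`, so `c₁ ≠ c₂`.

The scaled vorticity `W = (1-α)h + h_s - g_t` satisfies `g W_s + h W_t = (α+1) g W`. So does `Φ(ψ)`
when `Φ` is a power of exponent `ν = (α+1)/(α-1)` on each half-line, hence so does `E = W - Φ(ψ)`.
On an edge where `g_t` is constant `W` is constant, and the coefficients of `Φ` can be chosen to
give `E = 0` there. A maximum principle for periodic transport (`transport_eq_zero`) then yields `E
= 0` everywhere. If `c₁c₂ > 0`, then `ψ` has no zero, and multiplying `E` by a power of `ψ` gives
the zeroth order coefficient whichever sign the other edge requires. If `α > 1`, then `ν > 1`, so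
`Φ` is differentiable across `ψ = 0`, and each edge either carries `E = 0` or has `h = 0`.

Now `W = Φ(ψ)` is a semilinear elliptic equation for `ψ`, invariant under translation in `s`.
Formally `ψ_s` and `ψ_t = g` both solve its linearisation, so `ρ = ψ_s / g` solves an elliptic
equation without zeroth order term; it is periodic and vanishes on the edges, so it is zero
(`elliptic_eq_zero`). Hence `ψ`, `g` and `h` do not depend on `s`. The differential of the pressure
reduces to `exp(-2αs) Γ(t) ds`, which forces `Γ` to be constant and gives the pressure and the
equation for `f`. -/

open Filter Topology

/-- `F₁` and `F₂` are the partial derivatives of `F` on the rectangle `[0, S] × [0, T]`,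
one-sided at the edges. -/
def HasPartials (S T : ℝ) (F F₁ F₂ : ℝ → ℝ → ℝ) : Prop :=
  ∀ s ∈ Icc 0 S, ∀ t ∈ Icc 0 T,
    HasDerivWithinAt (fun x => F x t) (F₁ s t) (Icc 0 S) s ∧
      HasDerivWithinAt (fun y => F s y) (F₂ s t) (Icc 0 T) t

/-! ### Necessary conditions at a maximum on a closed interval -/

section OneVariable

variable {f f' : ℝ → ℝ} {a b x d : ℝ}

lemma hasDerivWithinAt_nonpos_of_isMaxOn (h : HasDerivWithinAt f d (Icc a b) x)
    (hmax : IsMaxOn f (Icc a b) x) (hx : x ∈ Ico a b) : d ≤ 0 := by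
  have h1 : HasDerivWithinAt f d (Ioo x b) x :=
    h.mono fun y hy => ⟨hx.1.trans hy.1.le, hy.2.le⟩
  have h2 := (hasDerivWithinAt_iff_tendsto_slope' (by simp)).1 h1
  have : (𝓝[Ioo x b] x).NeBot := left_nhdsWithin_Ioo_neBot hx.2
  refine le_of_tendsto h2 ?_
  filter_upwards [self_mem_nhdsWithin] with y hy
  rw [slope_def_field]
  exact div_nonpos_of_nonpos_of_nonneg
    (sub_nonpos.2 (hmax ⟨hx.1.trans hy.1.le, hy.2.le⟩)) (sub_nonneg.2 hy.1.le)

lemma hasDerivWithinAt_nonneg_of_isMaxOn (h : HasDerivWithinAt f d (Icc a b) x)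
    (hmax : IsMaxOn f (Icc a b) x) (hx : x ∈ Ioc a b) : 0 ≤ d := by
  have h1 : HasDerivWithinAt f d (Ioo a x) x :=
    h.mono fun y hy => ⟨hy.1.le, hy.2.le.trans hx.2⟩
  have h2 := (hasDerivWithinAt_iff_tendsto_slope' (by simp)).1 h1
  have : (𝓝[Ioo a x] x).NeBot := right_nhdsWithin_Ioo_neBot hx.1
  refine ge_of_tendsto h2 ?_
  filter_upwards [self_mem_nhdsWithin] with y hy
  rw [slope_def_field]
  exact div_nonneg_of_nonpos
    (sub_nonpos.2 (hmax ⟨hy.1.le, hy.2.le.trans hx.2⟩)) (sub_nonpos.2 hy.2.le)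

/-- Second order necessary condition at a maximum, at an endpoint if the derivative vanishes. -/
lemma second_deriv_nonpos_of_isMaxOn (hab : a < b)
    (hf : ∀ y ∈ Icc a b, HasDerivWithinAt f (f' y) (Icc a b) y)
    (hf' : HasDerivWithinAt f' d (Icc a b) x) (hmax : IsMaxOn f (Icc a b) x)
    (hx : x ∈ Icc a b) (h0 : f' x = 0) : d ≤ 0 := by
  by_contra! hd
  have hcont : ContinuousOn f (Icc a b) := fun y hy => (hf y hy).continuousWithinAt
  rcases hx.2.lt_or_eq with hxb | hxb
  -- If `d > 0` and `f' x = 0`, then `f'` is positive just to the right of `x`, so `f` increases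
  -- strictly away from its maximum. One side suffices, which is why endpoints are allowed; at `x =
  -- b` the left side is used.
  · have h1 : HasDerivWithinAt f' d (Ioo x b) x :=
      hf'.mono fun y hy => ⟨hx.1.trans hy.1.le, hy.2.le⟩
    have h2 := (hasDerivWithinAt_iff_tendsto_slope' (by simp)).1 h1
    have h3 := h2.eventually (lt_mem_nhds hd)
    rw [nhdsWithin_Ioo_eq_nhdsGT hxb] at h3
    obtain ⟨c, hc, hcs⟩ := (mem_nhdsGT_iff_exists_Ioo_subset' hxb).1 h3
    set e := min c b
    have he : x < e := lt_min hc hxb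
    have hsub : Icc x e ⊆ Icc a b := Icc_subset_Icc hx.1 (min_le_right _ _)
    have hmono : StrictMonoOn f (Icc x e) := by
      refine strictMonoOn_of_deriv_pos (convex_Icc _ _) (hcont.mono hsub) fun y hy => ?_
      rw [interior_Icc] at hy
      have hya : a < y := hx.1.trans_lt hy.1
      have hyb : y < b := hy.2.trans_le (min_le_right _ _)
      rw [((hf y ⟨hya.le, hyb.le⟩).hasDerivAt (Icc_mem_nhds hya hyb)).deriv]
      have := hcs ⟨hy.1, hy.2.trans_le (min_le_left _ _)⟩
      simp only [mem_ofPred_eq, slope_def_field, h0, sub_zero] at this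
      exact (div_pos_iff_of_pos_right (sub_pos.2 hy.1)).1 this
    exact absurd (hmono (left_mem_Icc.2 he.le) (right_mem_Icc.2 he.le) he)
      (not_lt.2 (hmax (hsub (right_mem_Icc.2 he.le))))
  · have hax : a < x := hxb ▸ hab
    have h1 : HasDerivWithinAt f' d (Ioo a x) x :=
      hf'.mono fun y hy => ⟨hy.1.le, hy.2.le.trans hx.2⟩
    have h2 := (hasDerivWithinAt_iff_tendsto_slope' (by simp)).1 h1
    have h3 := h2.eventually (lt_mem_nhds hd)
    rw [nhdsWithin_Ioo_eq_nhdsLT hax] at h3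
    obtain ⟨c, hc, hcs⟩ := (mem_nhdsLT_iff_exists_Ioo_subset' hax).1 h3
    set e := max c a
    have he : e < x := max_lt hc hax
    have hsub : Icc e x ⊆ Icc a b := Icc_subset_Icc (le_max_right _ _) hx.2
    have hanti : StrictAntiOn f (Icc e x) := by
      refine strictAntiOn_of_deriv_neg (convex_Icc _ _) (hcont.mono hsub) fun y hy => ?_
      rw [interior_Icc] at hy
      have hya : a < y := (le_max_right _ _).trans_lt hy.1
      have hyb : y < b := hy.2.trans_le hx.2
      rw [((hf y ⟨hya.le, hyb.le⟩).hasDerivAt (Icc_mem_nhds hya hyb)).deriv]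
      have := hcs ⟨(le_max_left _ _).trans_lt hy.1, hy.2⟩
      simp only [mem_ofPred_eq, slope_def_field, h0, sub_zero] at this
      by_contra! hneg
      exact absurd (div_nonpos_of_nonneg_of_nonpos hneg (sub_nonpos.2 hy.2.le)) (not_le.2 this)
    exact absurd (hanti (left_mem_Icc.2 he.le) (right_mem_Icc.2 he.le) he)
      (not_lt.2 (hmax (hsub (left_mem_Icc.2 he.le))))

end OneVariable

/-! ### Maximum principles with periodicity in one variable -/

section MaximumPrinciples

variable {S T : ℝ}

/-- A function that solves a transport equation with a zeroth order term of constant sign,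
is periodic in the first variable, and on each of the edges `t = 0`, `t = T` vanishes or is
transported in the favourable direction, vanishes identically. -/
theorem transport_eq_zero (hS : 0 < S) (hT : 0 < T) {E E₁ E₂ b : ℝ → ℝ → ℝ} {κ : ℝ} (hκ : κ ≠ 0)
    (hcont : ContinuousOn (fun x : ℝ × ℝ => E x.1 x.2) (Icc 0 S ×ˢ Icc 0 T))
    (hE : HasPartials S T E E₁ E₂)
    (hper : ∀ t ∈ Icc 0 T, E 0 t = E S t)
    (heq : ∀ s ∈ Icc 0 S, ∀ t ∈ Icc 0 T, E₁ s t + b s t * E₂ s t = κ * E s t)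
    (hbot : ∀ s ∈ Icc 0 S, E s 0 = 0 ∨ 0 ≤ κ * b s 0)
    (htop : ∀ s ∈ Icc 0 S, E s T = 0 ∨ κ * b s T ≤ 0) :
    ∀ s ∈ Icc 0 S, ∀ t ∈ Icc 0 T, E s t = 0 := by
  have h0S : (0 : ℝ) ∈ Icc 0 S := left_mem_Icc.2 hS.le
  have hSS : S ∈ Icc 0 S := right_mem_Icc.2 hS.le
  -- Maximising `E ^ 2` treats both signs of `E` at once.
  obtain ⟨⟨s₀, t₀⟩, ⟨hs₀, ht₀⟩, hmax⟩ :=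
    (isCompact_Icc.prod isCompact_Icc).exists_isMaxOn
      (⟨(0, 0), h0S, left_mem_Icc.2 hT.le⟩ : (Icc (0 : ℝ) S ×ˢ Icc (0 : ℝ) T).Nonempty)
      (hcont.pow 2)
  simp only at hs₀ ht₀
  by_cases hz : E s₀ t₀ = 0
  · intro s hs t ht
    have h := hmax (mk_mem_prod hs ht)
    simp only [mem_ofPred_eq, Pi.pow_apply, hz] at h
    nlinarith [sq_nonneg (E s t)]
  exfalso
  -- At a nonzero maximum of `E ^ 2` the `t` term cannot have the sign of `κ`, so `(E ^ 2)_s` has it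
  -- strictly. This is possible only at `s = S` for `κ > 0` and only at `s = 0` for `κ < 0`.
  have key : ∀ s ∈ Icc 0 S, E s t₀ ^ 2 = E s₀ t₀ ^ 2 →
      (κ > 0 → s < S → False) ∧ (κ < 0 → 0 < s → False) := by
    intro s hs hs'
    have hne : E s t₀ ≠ 0 := fun h => hz (by simpa [h] using hs'.symm)
    have hm1 : IsMaxOn (fun x => E x t₀ ^ 2) (Icc 0 S) s := fun x hx => by
      have := hmax (mk_mem_prod hx ht₀)
      simp only [mem_ofPred_eq, Pi.pow_apply] at this ⊢
      linarith
    have hm2 : IsMaxOn (fun y => E s y ^ 2) (Icc 0 T) t₀ := fun y hy => by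
      have := hmax (mk_mem_prod hs hy)
      simp only [mem_ofPred_eq, Pi.pow_apply] at this ⊢
      linarith
    obtain ⟨d1, d2⟩ := hE s hs t₀ ht₀
    replace d1 := d1.pow 2
    replace d2 := d2.pow 2
    simp only [Nat.cast_ofNat, Nat.add_one_sub_one, pow_one] at d1 d2
    have hpos : 0 < E s t₀ ^ 2 := by positivity
    have hN := heq s hs t₀ ht₀
    have hN' : 2 * E s t₀ * E₁ s t₀ + b s t₀ * (2 * E s t₀ * E₂ s t₀) = 2 * κ * E s t₀ ^ 2 := by
      linear_combination 2 * E s t₀ * hN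
    have hb : κ * (b s t₀ * (2 * E s t₀ * E₂ s t₀)) ≤ 0 := by
      have hbt : t₀ = 0 → 0 ≤ κ * b s t₀ := by
        rintro rfl; exact (hbot s hs).resolve_left hne
      have htt : t₀ = T → κ * b s t₀ ≤ 0 := by
        rintro rfl; exact (htop s hs).resolve_left hne
      rw [← mul_assoc]
      rcases ht₀.1.eq_or_lt with h | h
      · exact mul_nonpos_of_nonneg_of_nonpos (hbt h.symm)
          (hasDerivWithinAt_nonpos_of_isMaxOn d2 hm2 ⟨ht₀.1, h ▸ hT⟩)
      have h1 := hasDerivWithinAt_nonneg_of_isMaxOn d2 hm2 ⟨h, ht₀.2⟩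
      rcases ht₀.2.eq_or_lt with h' | h'
      · exact mul_nonpos_of_nonpos_of_nonneg (htt h') h1
      have h2 := hasDerivWithinAt_nonpos_of_isMaxOn d2 hm2 ⟨ht₀.1, h'⟩
      rw [le_antisymm h2 h1, mul_zero]
    constructor
    · intro hk hlt
      have h1 := hasDerivWithinAt_nonpos_of_isMaxOn d1 hm1 ⟨hs.1, hlt⟩
      have h2 : b s t₀ * (2 * E s t₀ * E₂ s t₀) ≤ 0 := by
        by_contra! h; exact absurd hb (not_le.2 (mul_pos hk h))
      have : 0 < 2 * κ * E s t₀ ^ 2 := by positivity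
      linarith
    · intro hk hlt
      have h1 := hasDerivWithinAt_nonneg_of_isMaxOn d1 hm1 ⟨hlt, hs.2⟩
      have h2 : 0 ≤ b s t₀ * (2 * E s t₀ * E₂ s t₀) := by
        by_contra! h; exact absurd hb (not_le.2 (mul_pos_of_neg_of_neg hk h))
      have : κ * E s t₀ ^ 2 < 0 := mul_neg_of_neg_of_pos hk hpos
      linarith
  -- Periodicity moves a maximum at the one admissible end to the other end, where it is excluded.
  rcases hκ.lt_or_gt with hk | hk
  · rcases hs₀.1.eq_or_lt with h | h
    · exact (key S hSS (by rw [← hper t₀ ht₀, h])).2 hk hS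
    · exact (key s₀ hs₀ rfl).2 hk h
  · rcases hs₀.2.eq_or_lt with h | h
    · exact (key 0 h0S (by rw [hper t₀ ht₀, h])).1 hk hS
    · exact (key s₀ hs₀ rfl).1 hk h

/-- The weak maximum principle for an elliptic equation without zeroth order term on a
rectangle, with periodicity in the first variable. -/
theorem elliptic_nonpos (hS : 0 < S) (hT : 0 < T) {ρ ρ₁ ρ₂ ρ₁₁ ρ₁₂ ρ₂₁ ρ₂₂ p q : ℝ → ℝ → ℝ} {M : ℝ}
    (hcont : ContinuousOn (fun x : ℝ × ℝ => ρ x.1 x.2) (Icc 0 S ×ˢ Icc 0 T))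
    (hρ : HasPartials S T ρ ρ₁ ρ₂) (hρ₁ : HasPartials S T ρ₁ ρ₁₁ ρ₁₂)
    (hρ₂ : HasPartials S T ρ₂ ρ₂₁ ρ₂₂)
    (hper : ∀ t ∈ Icc 0 T, ρ 0 t = ρ S t) (hper₁ : ∀ t ∈ Icc 0 T, ρ₁ 0 t = ρ₁ S t)
    (hq : ∀ s ∈ Icc 0 S, ∀ t ∈ Icc 0 T, |q s t| ≤ M)
    (heq : ∀ s ∈ Icc 0 S, ∀ t ∈ Icc 0 T,
      ρ₁₁ s t + ρ₂₂ s t + p s t * ρ₁ s t + q s t * ρ₂ s t = 0)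
    (hbot : ∀ s ∈ Icc 0 S, ρ s 0 = 0) (htop : ∀ s ∈ Icc 0 S, ρ s T = 0) :
    ∀ s ∈ Icc 0 S, ∀ t ∈ Icc 0 T, ρ s t ≤ 0 := by
  have h0S : (0 : ℝ) ∈ Icc 0 S := left_mem_Icc.2 hS.le
  have hSS : S ∈ Icc 0 S := right_mem_Icc.2 hS.le
  have h0T : (0 : ℝ) ∈ Icc 0 T := left_mem_Icc.2 hT.le
  have hM : 0 ≤ M := (abs_nonneg _).trans (hq 0 h0S 0 h0T)
  -- Chosen so that `l + q ≥ 1`: then `exp (l * t)` is a strict subsolution.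
  set l := M + 1
  have hl : 0 < l := by positivity
  have main : ∀ ε > 0, ∀ s ∈ Icc 0 S, ∀ t ∈ Icc 0 T,
      ρ s t + ε * exp (l * t) ≤ ε * exp (l * T) := by
    intro ε hε
    set Z : ℝ → ℝ → ℝ := fun s t => ρ s t + ε * exp (l * t)
    have hZc : ContinuousOn (fun x : ℝ × ℝ => Z x.1 x.2) (Icc 0 S ×ˢ Icc 0 T) := by
      refine hcont.add (Continuous.continuousOn ?_)
      fun_prop
    obtain ⟨⟨s₀, t₀⟩, ⟨hs₀, ht₀⟩, hmax⟩ :=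
      (isCompact_Icc.prod isCompact_Icc).exists_isMaxOn
        (⟨(0, 0), h0S, h0T⟩ : (Icc (0 : ℝ) S ×ˢ Icc (0 : ℝ) T).Nonempty) hZc
    simp only at hs₀ ht₀
    suffices hedge : t₀ = 0 ∨ t₀ = T by
      intro s hs t ht
      have h1 := hmax (mk_mem_prod hs ht)
      simp only [mem_ofPred_eq, Z] at h1
      refine h1.trans ?_
      have h2 : ρ s₀ t₀ = 0 := by
        rcases hedge with rfl | rfl
        exacts [hbot _ hs₀, htop _ hs₀]
      rw [h2, zero_add]
      have : l * t₀ ≤ l * T := mul_le_mul_of_nonneg_left ht₀.2 hl.le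
      gcongr
    by_contra! hne
    have ht1 : 0 < t₀ := lt_of_le_of_ne ht₀.1 (Ne.symm hne.1)
    have ht2 : t₀ < T := lt_of_le_of_ne ht₀.2 hne.2
    have hm1 : IsMaxOn (fun x => Z x t₀) (Icc 0 S) s₀ := fun x hx => hmax (mk_mem_prod hx ht₀)
    have hm2 : IsMaxOn (fun y => Z s₀ y) (Icc 0 T) t₀ := fun y hy => hmax (mk_mem_prod hs₀ hy)
    have hZper : Z 0 t₀ = Z S t₀ := by simp only [Z, hper t₀ ht₀]
    have D1 : ∀ s ∈ Icc 0 S, HasDerivWithinAt (fun x => Z x t₀) (ρ₁ s t₀) (Icc 0 S) s :=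
      fun s hs => (hρ s hs t₀ ht₀).1.add_const _
    have hexp : ∀ t, HasDerivAt (fun t => exp (l * t)) (l * exp (l * t)) t := fun t => by
      simpa [mul_comm] using ((hasDerivAt_id t).const_mul l).exp
    have D2 : ∀ t ∈ Icc 0 T, HasDerivWithinAt (fun y => Z s₀ y)
        (ρ₂ s₀ t + ε * (l * exp (l * t))) (Icc 0 T) t := fun t ht =>
      (hρ s₀ hs₀ t ht).2.add ((hexp t).const_mul ε).hasDerivWithinAt
    have D22 : HasDerivWithinAt (fun t => ρ₂ s₀ t + ε * (l * exp (l * t)))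
        (ρ₂₂ s₀ t₀ + ε * (l * (l * exp (l * t₀)))) (Icc 0 T) t₀ :=
      (hρ₂ s₀ hs₀ t₀ ht₀).2.add (((hexp t₀).const_mul l).const_mul ε).hasDerivWithinAt
    have z2 : ρ₂ s₀ t₀ + ε * (l * exp (l * t₀)) = 0 :=
      le_antisymm (hasDerivWithinAt_nonpos_of_isMaxOn (D2 t₀ ht₀) hm2 ⟨ht1.le, ht2⟩)
        (hasDerivWithinAt_nonneg_of_isMaxOn (D2 t₀ ht₀) hm2 ⟨ht1, ht2.le⟩)
    have z22 := second_deriv_nonpos_of_isMaxOn hT D2 D22 hm2 ht₀ z2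
    -- If the maximum is at an end in `s`, periodicity makes both ends maxima; the one-sided
    -- derivatives there have opposite weak signs and coincide. With `ρ₁ = 0` the coefficient `p`
    -- drops out, so it needs no bound.
    have z1 : ρ₁ s₀ t₀ = 0 := by
      have hm0 : s₀ = 0 ∨ s₀ = S → IsMaxOn (fun x => Z x t₀) (Icc 0 S) 0 ∧
          IsMaxOn (fun x => Z x t₀) (Icc 0 S) S := by
        rintro (rfl | rfl)
        · exact ⟨hm1, fun x hx => by simpa [← hZper] using hm1 hx⟩
        · exact ⟨fun x hx => by simpa [hZper] using hm1 hx, hm1⟩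
      by_cases hend : s₀ = 0 ∨ s₀ = S
      · have h := hm0 hend
        have a1 := hasDerivWithinAt_nonpos_of_isMaxOn (D1 0 h0S) h.1 ⟨le_rfl, hS⟩
        have a2 := hasDerivWithinAt_nonneg_of_isMaxOn (D1 S hSS) h.2 ⟨hS, le_rfl⟩
        have a3 := hper₁ t₀ ht₀
        rcases hend with rfl | rfl <;> linarith
      · push Not at hend
        exact le_antisymm
          (hasDerivWithinAt_nonpos_of_isMaxOn (D1 s₀ hs₀) hm1 ⟨hs₀.1, hs₀.2.lt_of_ne hend.2⟩)
          (hasDerivWithinAt_nonneg_of_isMaxOn (D1 s₀ hs₀) hm1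
            ⟨hs₀.1.lt_of_ne (Ne.symm hend.1), hs₀.2⟩)
    have z11 := second_deriv_nonpos_of_isMaxOn hS D1 (hρ₁ s₀ hs₀ t₀ ht₀).1 hm1 hs₀ z1
    have e := heq s₀ hs₀ t₀ ht₀
    rw [z1, mul_zero, add_zero] at e
    have e2 : ρ₂ s₀ t₀ = -(ε * (l * exp (l * t₀))) := by linarith
    rw [e2] at e
    have hqb : -M ≤ q s₀ t₀ := (abs_le.1 (hq s₀ hs₀ t₀ ht₀)).1
    have hpos : 0 < ε * (l * exp (l * t₀)) := by positivity
    have : 0 < ε * (l * exp (l * t₀)) * (l + q s₀ t₀) :=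
      mul_pos hpos (by simp only [l]; linarith)
    nlinarith
  -- Let `ε` tend to `0` in `main`.
  intro s hs t ht
  have hlim : Tendsto (fun ε : ℝ => ε * exp (l * T)) (𝓝[>] 0) (𝓝 0) := by
    have : Tendsto (fun ε : ℝ => ε * exp (l * T)) (𝓝 0) (𝓝 (0 * exp (l * T))) :=
      tendsto_id.mul_const _
    rw [zero_mul] at this
    exact this.mono_left nhdsWithin_le_nhds
  refine ge_of_tendsto hlim ?_
  filter_upwards [self_mem_nhdsWithin] with ε hε
  have := main ε hε s hs t ht
  have h2 : 0 < ε * exp (l * t) := mul_pos hε (exp_pos _)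
  linarith

theorem elliptic_eq_zero (hS : 0 < S) (hT : 0 < T) {ρ ρ₁ ρ₂ ρ₁₁ ρ₁₂ ρ₂₁ ρ₂₂ p q : ℝ → ℝ → ℝ} {M : ℝ}
    (hcont : ContinuousOn (fun x : ℝ × ℝ => ρ x.1 x.2) (Icc 0 S ×ˢ Icc 0 T))
    (hρ : HasPartials S T ρ ρ₁ ρ₂) (hρ₁ : HasPartials S T ρ₁ ρ₁₁ ρ₁₂)
    (hρ₂ : HasPartials S T ρ₂ ρ₂₁ ρ₂₂)
    (hper : ∀ t ∈ Icc 0 T, ρ 0 t = ρ S t) (hper₁ : ∀ t ∈ Icc 0 T, ρ₁ 0 t = ρ₁ S t)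
    (hq : ∀ s ∈ Icc 0 S, ∀ t ∈ Icc 0 T, |q s t| ≤ M)
    (heq : ∀ s ∈ Icc 0 S, ∀ t ∈ Icc 0 T,
      ρ₁₁ s t + ρ₂₂ s t + p s t * ρ₁ s t + q s t * ρ₂ s t = 0)
    (hbot : ∀ s ∈ Icc 0 S, ρ s 0 = 0) (htop : ∀ s ∈ Icc 0 S, ρ s T = 0) :
    ∀ s ∈ Icc 0 S, ∀ t ∈ Icc 0 T, ρ s t = 0 := by
  have hneg : ∀ {F F₁ F₂ : ℝ → ℝ → ℝ}, HasPartials S T F F₁ F₂ →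
      HasPartials S T (fun s t => -F s t) (fun s t => -F₁ s t) (fun s t => -F₂ s t) :=
    fun h s hs t ht => ⟨(h s hs t ht).1.neg, (h s hs t ht).2.neg⟩
  intro s hs t ht
  have h1 := elliptic_nonpos hS hT hcont hρ hρ₁ hρ₂ hper hper₁ hq heq hbot htop s hs t ht
  have h2 := elliptic_nonpos hS hT (p := p) (q := q) hcont.neg (hneg hρ) (hneg hρ₁) (hneg hρ₂)
    (fun t ht => by rw [hper t ht]) (fun t ht => by rw [hper₁ t ht]) hq
    (fun s hs t ht => by linear_combination -heq s hs t ht)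
    (fun s hs => by rw [hbot s hs, neg_zero]) (fun s hs => by rw [htop s hs, neg_zero]) s hs t ht
  linarith

end MaximumPrinciples

/-! ### Calculus on the closed rectangle: partial derivatives, closed forms, mixed derivatives -/

section Rectangle

variable {S T : ℝ}

/-- The rectangle `[0, S] × [0, T]`. -/
abbrev rect (S T : ℝ) : Set (ℝ × ℝ) := Icc 0 S ×ˢ Icc 0 T

lemma uniqueDiffOn_rect (hS : 0 < S) (hT : 0 < T) : UniqueDiffOn ℝ (rect S T) :=
  (uniqueDiffOn_Icc hS).prod (uniqueDiffOn_Icc hT)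

lemma rect_subset_closure_interior (hS : 0 < S) (hT : 0 < T) :
    rect S T ⊆ closure (interior (rect S T)) := by
  rw [rect, interior_prod_eq, closure_prod_eq, interior_Icc, interior_Icc, closure_Ioo hS.ne,
    closure_Ioo hT.ne]

lemma HasFDerivWithinAt.partials {F : ℝ × ℝ → ℝ} {L : ℝ × ℝ →L[ℝ] ℝ} {s t : ℝ}
    (h : HasFDerivWithinAt F L (rect S T) (s, t)) (hs : s ∈ Icc 0 S) (ht : t ∈ Icc 0 T) :
    HasDerivWithinAt (fun x => F (x, t)) (L (1, 0)) (Icc 0 S) s ∧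
      HasDerivWithinAt (fun y => F (s, y)) (L (0, 1)) (Icc 0 T) t := by
  constructor
  · exact h.comp_hasDerivWithinAt (f := fun x => (x, t)) s
      ((hasDerivWithinAt_id s _).prodMk (hasDerivWithinAt_const s _ t))
      fun x hx => mk_mem_prod hx ht
  · exact h.comp_hasDerivWithinAt (f := fun y => (s, y)) t
      ((hasDerivWithinAt_const t _ s).prodMk (hasDerivWithinAt_id t _))
      fun x hx => mk_mem_prod hs hx

/-- `F` is `C²` on the rectangle `[0, S] × [0, T]`, with the given partial derivatives. -/
structure C2Data (S T : ℝ) (F F₁ F₂ F₁₁ F₁₂ F₂₂ : ℝ → ℝ → ℝ) : Prop where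
  contDiffOn : ContDiffOn ℝ 2 (fun x : ℝ × ℝ => F x.1 x.2) (rect S T)
  contDiffOn₁ : ContDiffOn ℝ 1 (fun x : ℝ × ℝ => F₁ x.1 x.2) (rect S T)
  contDiffOn₂ : ContDiffOn ℝ 1 (fun x : ℝ × ℝ => F₂ x.1 x.2) (rect S T)
  continuousOn₁₁ : ContinuousOn (fun x : ℝ × ℝ => F₁₁ x.1 x.2) (rect S T)
  continuousOn₁₂ : ContinuousOn (fun x : ℝ × ℝ => F₁₂ x.1 x.2) (rect S T)
  continuousOn₂₂ : ContinuousOn (fun x : ℝ × ℝ => F₂₂ x.1 x.2) (rect S T)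
  partials : HasPartials S T F F₁ F₂
  partials₁ : HasPartials S T F₁ F₁₁ F₁₂
  partials₂ : HasPartials S T F₂ F₁₂ F₂₂

theorem ContDiffOn.exists_c2Data (hS : 0 < S) (hT : 0 < T) {F : ℝ → ℝ → ℝ}
    (hF : ContDiffOn ℝ 2 (fun x : ℝ × ℝ => F x.1 x.2) (rect S T)) :
    ∃ F₁ F₂ F₁₁ F₁₂ F₂₂ : ℝ → ℝ → ℝ, C2Data S T F F₁ F₂ F₁₁ F₁₂ F₂₂ := by
  set Q := rect S T
  have hQ : UniqueDiffOn ℝ Q := uniqueDiffOn_rect hS hT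
  set f : ℝ × ℝ → ℝ := fun x => F x.1 x.2
  set df := fderivWithin ℝ f Q
  set ddf := fderivWithin ℝ df Q
  have hdf : ContDiffOn ℝ 1 df Q := hF.fderivWithin hQ (by norm_num)
  have hddf : ContDiffOn ℝ 0 ddf Q := hdf.fderivWithin hQ (by norm_num)
  have h1 : ∀ x ∈ Q, HasFDerivWithinAt f (df x) Q x := fun x hx =>
    ((hF.differentiableOn (by norm_num)) x hx).hasFDerivWithinAt
  have h2 : ∀ x ∈ Q, HasFDerivWithinAt df (ddf x) Q x := fun x hx =>
    ((hdf.differentiableOn (by norm_num)) x hx).hasFDerivWithinAt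
  have h2v : ∀ x ∈ Q, ∀ v, HasFDerivWithinAt (fun y => df y v) ((ddf x).flip v) Q x :=
    fun x hx v => by
      have := (h2 x hx).clm_apply (hasFDerivWithinAt_const v x Q)
      simpa using this
  have hc : ∀ v w, ContinuousOn (fun x => ddf x v w) Q := fun v w =>
    (hddf.continuousOn.clm_apply continuousOn_const).clm_apply continuousOn_const
  refine ⟨fun s t => df (s, t) (1, 0), fun s t => df (s, t) (0, 1),
    fun s t => ddf (s, t) (1, 0) (1, 0), fun s t => ddf (s, t) (1, 0) (0, 1),
    fun s t => ddf (s, t) (0, 1) (0, 1), hF, hdf.clm_apply contDiffOn_const,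
    hdf.clm_apply contDiffOn_const, hc _ _, hc _ _, hc _ _, ?_, ?_, ?_⟩
  · intro s hs t ht
    exact (h1 (s, t) (mk_mem_prod hs ht)).partials hs ht
  · intro s hs t ht
    -- Symmetry persists up to the boundary because the rectangle lies in the closure of its
    -- interior; hence a single `F₁₂` serves for both mixed derivatives.
    have hsym : IsSymmSndFDerivWithinAt ℝ f Q (s, t) :=
      (hF (s, t) (mk_mem_prod hs ht)).isSymmSndFDerivWithinAt (by simp) hQ
        (rect_subset_closure_interior hS hT (mk_mem_prod hs ht)) (mk_mem_prod hs ht)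
    have := (h2v (s, t) (mk_mem_prod hs ht) (1, 0)).partials hs ht
    simp only [ContinuousLinearMap.flip_apply] at this
    refine ⟨this.1, ?_⟩
    show HasDerivWithinAt _ (ddf (s, t) (1, 0) (0, 1)) _ _
    rw [hsym.eq]
    exact this.2
  · intro s hs t ht
    have := (h2v (s, t) (mk_mem_prod hs ht) (0, 1)).partials hs ht
    simpa only [ContinuousLinearMap.flip_apply] using this

/-- The 1-form `a ds + b dt`. -/
def oneForm (a b : ℝ) : ℝ × ℝ →L[ℝ] ℝ :=
  a • ContinuousLinearMap.fst ℝ ℝ ℝ + b • ContinuousLinearMap.snd ℝ ℝ ℝ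

@[simp] lemma oneForm_apply (a b : ℝ) (v : ℝ × ℝ) : oneForm a b v = a * v.1 + b * v.2 := by
  simp [oneForm]

lemma eq_oneForm (L : ℝ × ℝ →L[ℝ] ℝ) : L = oneForm (L (1, 0)) (L (0, 1)) := by
  ext <;> simp

lemma HasFDerivWithinAt.oneForm {A B : ℝ × ℝ → ℝ} {A' B' : ℝ × ℝ →L[ℝ] ℝ} {Q : Set (ℝ × ℝ)}
    {x : ℝ × ℝ} (hA : HasFDerivWithinAt A A' Q x) (hB : HasFDerivWithinAt B B' Q x) :
    HasFDerivWithinAt (fun x => oneForm (A x) (B x))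
      (A'.smulRight (ContinuousLinearMap.fst ℝ ℝ ℝ) +
        B'.smulRight (ContinuousLinearMap.snd ℝ ℝ ℝ)) Q x :=
  (hA.smul_const (ContinuousLinearMap.fst ℝ ℝ ℝ : ℝ × ℝ →L[ℝ] ℝ)).add
    (hB.smul_const (ContinuousLinearMap.snd ℝ ℝ ℝ : ℝ × ℝ →L[ℝ] ℝ))

lemma ContDiffOn.hasFDerivWithinAt_of_partials (hS : 0 < S) (hT : 0 < T) {A A₁ A₂ : ℝ → ℝ → ℝ}
    (hA : ContDiffOn ℝ 1 (fun x : ℝ × ℝ => A x.1 x.2) (rect S T)) (hA' : HasPartials S T A A₁ A₂)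
    {s t : ℝ} (hs : s ∈ Icc 0 S) (ht : t ∈ Icc 0 T) :
    HasFDerivWithinAt (fun x : ℝ × ℝ => A x.1 x.2) (oneForm (A₁ s t) (A₂ s t)) (rect S T)
      (s, t) := by
  have h1 := ((hA.differentiableOn (by norm_num)) (s, t) (mk_mem_prod hs ht)).hasFDerivWithinAt
  have h2 := h1.partials hs ht
  rw [eq_oneForm (fderivWithin ℝ _ _ _)] at h1
  rwa [(uniqueDiffOn_Icc hS s hs).eq_deriv _ (hA' s hs t ht).1 h2.1,
    (uniqueDiffOn_Icc hT t ht).eq_deriv _ (hA' s hs t ht).2 h2.2]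

/-- A closed `C¹` form on the rectangle has a potential. -/
theorem exists_potential (hS : 0 < S) (hT : 0 < T) {A A₁ B B₂ C : ℝ → ℝ → ℝ}
    (hA : ContDiffOn ℝ 1 (fun x : ℝ × ℝ => A x.1 x.2) (rect S T))
    (hB : ContDiffOn ℝ 1 (fun x : ℝ × ℝ => B x.1 x.2) (rect S T))
    (hA' : HasPartials S T A A₁ C) (hB' : HasPartials S T B C B₂) :
    ∃ Ψ : ℝ → ℝ → ℝ, HasPartials S T Ψ A B ∧
      ContinuousOn (fun x : ℝ × ℝ => Ψ x.1 x.2) (rect S T) := by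
  have hconv : Convex ℝ (rect S T) := (convex_Icc 0 S).prod (convex_Icc 0 T)
  -- Poincaré lemma on a convex set. Closedness is encoded by the shared function `C` in `hA'` and
  -- `hB'`.
  obtain ⟨f, hf⟩ := hconv.exists_forall_hasFDerivWithinAt_of_hasFDerivWithinAt_symmetric
    (ω := fun x : ℝ × ℝ => oneForm (A x.1 x.2) (B x.1 x.2))
    (fun x hx => (hA.hasFDerivWithinAt_of_partials hS hT hA' hx.1 hx.2).oneForm
      (hB.hasFDerivWithinAt_of_partials hS hT hB' hx.1 hx.2))
    (fun a _ x _ y _ => by simp; ring)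
  refine ⟨fun s t => f (s, t), fun s hs t ht => ?_, fun x hx => (hf x hx).continuousWithinAt⟩
  have := (hf (s, t) (mk_mem_prod hs ht)).partials hs ht
  simpa using this

/-- The mixed second derivatives of a twice differentiable function agree in the interior. -/
theorem mixed_partials_eq (hS : 0 < S) (hT : 0 < T) {p A A₁ A₂ B B₁ B₂ : ℝ → ℝ → ℝ}
    (hA : ContDiffOn ℝ 1 (fun x : ℝ × ℝ => A x.1 x.2) (rect S T))
    (hB : ContDiffOn ℝ 1 (fun x : ℝ × ℝ => B x.1 x.2) (rect S T))
    (hA' : HasPartials S T A A₁ A₂) (hB' : HasPartials S T B B₁ B₂)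
    (hp : ∀ x ∈ Ioo 0 S ×ˢ Ioo 0 T, HasFDerivAt (fun x : ℝ × ℝ => p x.1 x.2)
      (oneForm (A x.1 x.2) (B x.1 x.2)) x) {s t : ℝ} (hs : s ∈ Ioo 0 S) (ht : t ∈ Ioo 0 T) :
    A₂ s t = B₁ s t := by
  have hs' := Ioo_subset_Icc_self hs
  have ht' := Ioo_subset_Icc_self ht
  have hopen : Ioo 0 S ×ˢ Ioo 0 T ∈ 𝓝 (s, t) :=
    (isOpen_Ioo.prod isOpen_Ioo).mem_nhds (mk_mem_prod hs ht)
  have hQ : rect S T ∈ 𝓝 (s, t) :=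
    mem_of_superset hopen (prod_mono Ioo_subset_Icc_self Ioo_subset_Icc_self)
  have h := ((hA.hasFDerivWithinAt_of_partials hS hT hA' hs' ht').oneForm
      (hB.hasFDerivWithinAt_of_partials hS hT hB' hs' ht')).hasFDerivAt hQ
  have := second_derivative_symmetric_of_eventually
    (mem_of_superset hopen hp) h (0, 1) (1, 0)
  simpa using this

/-- Identities between continuous functions extend from the open rectangle to its closure. -/
lemma eqOn_rect_of_interior (hS : 0 < S) (hT : 0 < T) {A B : ℝ × ℝ → ℝ}
    (hA : ContinuousOn A (rect S T)) (hB : ContinuousOn B (rect S T))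
    (h : ∀ s ∈ Ioo 0 S, ∀ t ∈ Ioo 0 T, A (s, t) = B (s, t)) {s t : ℝ}
    (hs : s ∈ Icc 0 S) (ht : t ∈ Icc 0 T) : A (s, t) = B (s, t) := by
  have : EqOn A B (Ioo 0 S ×ˢ Ioo 0 T) := fun x hx => h x.1 hx.1 x.2 hx.2
  refine this.of_subset_closure hA hB (prod_mono Ioo_subset_Icc_self Ioo_subset_Icc_self) ?_
    (mk_mem_prod hs ht)
  rw [closure_prod_eq, closure_Ioo hS.ne, closure_Ioo hT.ne]

end Rectangle

/-! ### Rules for partial derivatives, and one-variable tools -/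

section PartialsAlgebra

variable {S T : ℝ} {F F₁ F₂ G G₁ G₂ : ℝ → ℝ → ℝ}

lemma HasPartials.congr {F₁' F₂' : ℝ → ℝ → ℝ} (h : HasPartials S T F F₁ F₂)
    (h1 : ∀ s ∈ Icc 0 S, ∀ t ∈ Icc 0 T, F₁ s t = F₁' s t)
    (h2 : ∀ s ∈ Icc 0 S, ∀ t ∈ Icc 0 T, F₂ s t = F₂' s t) : HasPartials S T F F₁' F₂' :=
  fun s hs t ht => by rw [← h1 s hs t ht, ← h2 s hs t ht]; exact h s hs t ht

lemma HasPartials.add (hF : HasPartials S T F F₁ F₂) (hG : HasPartials S T G G₁ G₂) :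
    HasPartials S T (fun s t => F s t + G s t) (fun s t => F₁ s t + G₁ s t)
      (fun s t => F₂ s t + G₂ s t) :=
  fun s hs t ht => ⟨(hF s hs t ht).1.add (hG s hs t ht).1, (hF s hs t ht).2.add (hG s hs t ht).2⟩

lemma HasPartials.sub (hF : HasPartials S T F F₁ F₂) (hG : HasPartials S T G G₁ G₂) :
    HasPartials S T (fun s t => F s t - G s t) (fun s t => F₁ s t - G₁ s t)
      (fun s t => F₂ s t - G₂ s t) :=
  fun s hs t ht => ⟨(hF s hs t ht).1.sub (hG s hs t ht).1, (hF s hs t ht).2.sub (hG s hs t ht).2⟩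

lemma HasPartials.neg (hF : HasPartials S T F F₁ F₂) :
    HasPartials S T (fun s t => -F s t) (fun s t => -F₁ s t) (fun s t => -F₂ s t) :=
  fun s hs t ht => ⟨(hF s hs t ht).1.neg, (hF s hs t ht).2.neg⟩

lemma HasPartials.const_mul (c : ℝ) (hF : HasPartials S T F F₁ F₂) :
    HasPartials S T (fun s t => c * F s t) (fun s t => c * F₁ s t) (fun s t => c * F₂ s t) :=
  fun s hs t ht => ⟨(hF s hs t ht).1.const_mul c, (hF s hs t ht).2.const_mul c⟩

lemma HasPartials.mul (hF : HasPartials S T F F₁ F₂) (hG : HasPartials S T G G₁ G₂) :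
    HasPartials S T (fun s t => F s t * G s t) (fun s t => F₁ s t * G s t + F s t * G₁ s t)
      (fun s t => F₂ s t * G s t + F s t * G₂ s t) :=
  fun s hs t ht => ⟨(hF s hs t ht).1.mul (hG s hs t ht).1, (hF s hs t ht).2.mul (hG s hs t ht).2⟩

lemma HasPartials.div (hF : HasPartials S T F F₁ F₂) (hG : HasPartials S T G G₁ G₂)
    (hne : ∀ s ∈ Icc 0 S, ∀ t ∈ Icc 0 T, G s t ≠ 0) :
    HasPartials S T (fun s t => F s t / G s t)
      (fun s t => (F₁ s t * G s t - F s t * G₁ s t) / G s t ^ 2)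
      (fun s t => (F₂ s t * G s t - F s t * G₂ s t) / G s t ^ 2) :=
  fun s hs t ht => ⟨(hF s hs t ht).1.div (hG s hs t ht).1 (hne s hs t ht),
    (hF s hs t ht).2.div (hG s hs t ht).2 (hne s hs t ht)⟩

lemma HasPartials.comp {Φ : ℝ → ℝ} {d : ℝ → ℝ → ℝ} (hF : HasPartials S T F F₁ F₂)
    (hΦ : ∀ s ∈ Icc 0 S, ∀ t ∈ Icc 0 T, HasDerivAt Φ (d s t) (F s t)) :
    HasPartials S T (fun s t => Φ (F s t)) (fun s t => d s t * F₁ s t)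
      (fun s t => d s t * F₂ s t) :=
  fun s hs t ht => ⟨(hΦ s hs t ht).comp_hasDerivWithinAt s (hF s hs t ht).1,
    (hΦ s hs t ht).comp_hasDerivWithinAt t (hF s hs t ht).2⟩

lemma hasPartials_of_deriv {e e' : ℝ → ℝ} (h : ∀ s, HasDerivAt e (e' s) s) :
    HasPartials S T (fun s _ => e s) (fun s _ => e' s) (fun _ _ => 0) :=
  fun s _ t _ => ⟨(h s).hasDerivWithinAt, hasDerivWithinAt_const t _ (e s)⟩

/-- Periodicity in the first variable is inherited by the derivative in the second one. -/
lemma HasPartials.periodic_snd (hF : HasPartials S T F F₁ F₂) (hS : 0 < S) (hT : 0 < T)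
    (hper : ∀ t ∈ Icc 0 T, F 0 t = F S t) : ∀ t ∈ Icc 0 T, F₂ 0 t = F₂ S t := by
  intro t ht
  exact (uniqueDiffOn_Icc hT t ht).eq_deriv _ (hF 0 (left_mem_Icc.2 hS.le) t ht).2
    ((hF S (right_mem_Icc.2 hS.le) t ht).2.congr hper (hper t ht))

/-- A function that vanishes on the rectangle has vanishing partial derivatives. -/
lemma HasPartials.eq_zero (hF : HasPartials S T F F₁ F₂) (hS : 0 < S) (hT : 0 < T)
    (h0 : ∀ s ∈ Icc 0 S, ∀ t ∈ Icc 0 T, F s t = 0) {s t : ℝ} (hs : s ∈ Icc 0 S)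
    (ht : t ∈ Icc 0 T) : F₁ s t = 0 ∧ F₂ s t = 0 :=
  ⟨(uniqueDiffOn_Icc hS s hs).eq_deriv _ (hF s hs t ht).1
      ((hasDerivWithinAt_const s _ (0 : ℝ)).congr (fun x hx => h0 x hx t ht) (h0 s hs t ht)),
    (uniqueDiffOn_Icc hT t ht).eq_deriv _ (hF s hs t ht).2
      ((hasDerivWithinAt_const t _ (0 : ℝ)).congr (fun x hx => h0 s hs x hx) (h0 s hs t ht))⟩

end PartialsAlgebra

lemma eq_left_of_hasDerivWithinAt_zero {f : ℝ → ℝ} {a b : ℝ}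
    (h : ∀ x ∈ Icc a b, HasDerivWithinAt f 0 (Icc a b) x) : ∀ x ∈ Icc a b, f x = f a := by
  intro x hx
  refine constant_of_derivWithin_zero (fun y hy => (h y hy).differentiableWithinAt)
    (fun y hy => ?_) x hx
  exact (h y ⟨hy.1, hy.2.le⟩).derivWithin
    (uniqueDiffOn_Icc (hy.1.trans_lt hy.2) y ⟨hy.1, hy.2.le⟩)

lemma strictMonoOn_Icc_of_hasDerivWithinAt_pos {f f' : ℝ → ℝ} {a b : ℝ}
    (h : ∀ x ∈ Icc a b, HasDerivWithinAt f (f' x) (Icc a b) x) (hpos : ∀ x ∈ Icc a b, 0 < f' x) :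
    StrictMonoOn f (Icc a b) :=
  strictMonoOn_of_hasDerivWithinAt_pos (convex_Icc _ _)
    (fun y hy => (h y hy).continuousWithinAt)
    (fun x hx => (h x (interior_subset hx)).mono interior_subset)
    fun x hx => hpos x (interior_subset hx)

lemma strictAntiOn_Icc_of_hasDerivWithinAt_neg {f f' : ℝ → ℝ} {a b : ℝ}
    (h : ∀ x ∈ Icc a b, HasDerivWithinAt f (f' x) (Icc a b) x) (hneg : ∀ x ∈ Icc a b, f' x < 0) :
    StrictAntiOn f (Icc a b) :=
  strictAntiOn_of_hasDerivWithinAt_neg (convex_Icc _ _)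
    (fun y hy => (h y hy).continuousWithinAt)
    (fun x hx => (h x (interior_subset hx)).mono interior_subset)
    fun x hx => hneg x (interior_subset hx)

lemma IsPreconnected.pos_or_neg {X : Type*} [TopologicalSpace X] {s : Set X}
    (hs : IsPreconnected s) {f : X → ℝ} (hf : ContinuousOn f s) (hne : ∀ x ∈ s, f x ≠ 0) :
    (∀ x ∈ s, 0 < f x) ∨ ∀ x ∈ s, f x < 0 := by
  by_contra! h
  obtain ⟨⟨x, hx, hx0⟩, ⟨y, hy, hy0⟩⟩ := h
  obtain ⟨z, hz, hz0⟩ := hs.intermediate_value hx hy hf ⟨hx0, hy0⟩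
  exact hne z hz hz0

/-- Supplies the exponent of `ψ` that adjusts the sign of a zeroth order coefficient. -/
lemma exists_int_add_mul_pos (x : ℝ) {y : ℝ} (hy : y ≠ 0) : ∃ n : ℤ, 0 < x + n * y := by
  rcases hy.lt_or_gt with h | h
  · obtain ⟨n, hn⟩ := exists_int_lt (-x / y)
    refine ⟨n, ?_⟩
    rw [lt_div_iff_of_neg h] at hn
    linarith
  · obtain ⟨n, hn⟩ := exists_int_gt (-x / y)
    refine ⟨n, ?_⟩
    rw [div_lt_iff₀ h] at hn
    linarith

/-! ### The power law relating vorticity and stream function -/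

section VorticityFunction

/-- `x ↦ K max(x, 0) ^ ν + K' max(-x, 0) ^ ν`. -/
noncomputable def signedPower (ν K K' x : ℝ) : ℝ := K * max x 0 ^ ν + K' * max (-x) 0 ^ ν

/-- The second conclusion is Euler's identity for homogeneous functions, the only property of the
derivative needed later. -/
lemma hasDerivAt_max_rpow {ν x : ℝ} (h : x ≠ 0 ∨ 1 < ν) :
    ∃ d, HasDerivAt (fun x => max x 0 ^ ν) d x ∧ x * d = ν * max x 0 ^ ν := by
  rcases lt_trichotomy x 0 with hx | rfl | hx
  · refine ⟨0, ?_, ?_⟩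
    · refine (hasDerivAt_const x ((0 : ℝ) ^ ν)).congr_of_eventuallyEq ?_
      filter_upwards [Iio_mem_nhds hx] with y hy
      rw [max_eq_right (le_of_lt hy)]
    · rw [max_eq_right hx.le, mul_zero]
      by_cases hν : ν = 0
      · simp [hν]
      · rw [zero_rpow hν, mul_zero]
  · have hν : 1 < ν := h.resolve_left (by simp)
    refine ⟨0, ?_, by rw [max_self, zero_rpow (by positivity)]; ring⟩
    -- At the origin the function is dominated by `|x| ^ ν`, which is `o(x)` for `ν > 1`.
    have h1 : HasDerivAt (fun x : ℝ => |x| ^ ν) 0 0 := by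
      simpa using hasDerivAt_abs_rpow (0 : ℝ) hν
    rw [hasDerivAt_iff_isLittleO_nhds_zero] at h1 ⊢
    refine (Asymptotics.IsBigO.of_bound 1 (Eventually.of_forall fun y => ?_)).trans_isLittleO h1
    simp only [zero_add, max_self, smul_zero, sub_zero, abs_zero, one_mul, norm_eq_abs,
      zero_rpow (show ν ≠ 0 by positivity)]
    rw [abs_of_nonneg (rpow_nonneg (le_max_right _ _) _), abs_of_nonneg (by positivity)]
    exact rpow_le_rpow (le_max_right _ _) (max_le (le_abs_self y) (abs_nonneg y)) (by positivity)
  · refine ⟨ν * x ^ (ν - 1), ?_, ?_⟩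
    · refine (hasDerivAt_rpow_const (Or.inl hx.ne')).congr_of_eventuallyEq ?_
      filter_upwards [Ioi_mem_nhds hx] with y hy
      rw [max_eq_left (le_of_lt hy)]
    · rw [max_eq_left hx.le, rpow_sub_one hx.ne']
      field_simp

lemma signedPower_hasDerivAt {ν x : ℝ} (K K' : ℝ) (h : x ≠ 0 ∨ 1 < ν) :
    ∃ d, HasDerivAt (signedPower ν K K') d x ∧ x * d = ν * signedPower ν K K' x := by
  obtain ⟨d, hd, hd'⟩ := hasDerivAt_max_rpow h
  obtain ⟨e, he, he'⟩ := hasDerivAt_max_rpow (x := -x) (ν := ν) (h.imp_left neg_ne_zero.2)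
  refine ⟨K * d + K' * (e * -1), (hd.const_mul K).add ((he.comp x (hasDerivAt_neg x)).const_mul K'),
    ?_⟩
  rw [signedPower]
  linear_combination K * hd' + K' * he'

lemma exists_signedPower_eq {ν x : ℝ} (hx : x ≠ 0) (y : ℝ) :
    ∃ K K', signedPower ν K K' x = y := by
  rcases hx.lt_or_gt with h | h
  · refine ⟨0, y / (-x) ^ ν, ?_⟩
    rw [signedPower, max_eq_left (by linarith : 0 ≤ -x), zero_mul, zero_add,
      div_mul_cancel₀ _ (rpow_pos_of_pos (neg_pos.2 h) ν).ne']
  · refine ⟨y / x ^ ν, 0, ?_⟩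
    rw [signedPower, max_eq_left h.le, zero_mul, add_zero,
      div_mul_cancel₀ _ (rpow_pos_of_pos h ν).ne']

/-- At points of opposite sign the two coefficients act independently. `ν ≠ 0` is needed because `0
^ 0 = 1` would mix them. -/
lemma exists_signedPower_eq_eq {ν x x' : ℝ} (hν : ν ≠ 0) (hx : x * x' < 0) (y y' : ℝ) :
    ∃ K K', signedPower ν K K' x = y ∧ signedPower ν K K' x' = y' := by
  have key : ∀ {a b : ℝ}, 0 < a → b < 0 → ∀ z w, ∃ K K', signedPower ν K K' a = z ∧
      signedPower ν K K' b = w := by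
    intro a b ha hb z w
    refine ⟨z / a ^ ν, w / (-b) ^ ν, ?_, ?_⟩
    · rw [signedPower, max_eq_left ha.le, max_eq_right (by linarith : -a ≤ 0), zero_rpow hν,
        mul_zero, add_zero, div_mul_cancel₀ _ (rpow_pos_of_pos ha ν).ne']
    · rw [signedPower, max_eq_right hb.le, max_eq_left (by linarith : 0 ≤ -b), zero_rpow hν,
        mul_zero, zero_add, div_mul_cancel₀ _ (rpow_pos_of_pos (neg_pos.2 hb) ν).ne']
  rcases mul_neg_iff.1 hx with ⟨h, h'⟩ | ⟨h, h'⟩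
  · exact key h h' y y'
  · obtain ⟨K, K', h1, h2⟩ := key h' h y' y
    exact ⟨K, K', h2, h1⟩

end VorticityFunction

/-! ### The flow in logarithmic polar coordinates and its stream function -/

/-- A steady Euler flow in the coordinates `s = log r`, `t = θ` on the rectangle
`[0, S] × [0, T]`: `g = r ^ α u_r`, `h = r ^ α u_θ`, with their derivatives up to second order. -/
structure LogPolarFlow (α S T c₁ c₂ : ℝ) where
  (g g₁ g₂ g₁₁ g₁₂ g₂₂ h h₁ h₂ h₁₁ h₁₂ h₂₂ : ℝ → ℝ → ℝ)
  S_pos : 0 < S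
  T_pos : 0 < T
  α_ne : α ≠ 1
  g_data : C2Data S T g g₁ g₂ g₁₁ g₁₂ g₂₂
  h_data : C2Data S T h h₁ h₂ h₁₁ h₁₂ h₂₂
  g_ne : ∀ s ∈ Icc 0 S, ∀ t ∈ Icc 0 T, g s t ≠ 0
  div_eq : ∀ s ∈ Icc 0 S, ∀ t ∈ Icc 0 T, g₁ s t + h₂ s t + (1 - α) * g s t = 0
  vorticity_eq : ∀ s ∈ Icc 0 S, ∀ t ∈ Icc 0 T,
    g s t * ((1 - α) * h₁ s t + h₁₁ s t - g₁₂ s t) + h s t * ((1 - α) * h₂ s t + h₁₂ s t - g₂₂ s t) =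
      (α + 1) * g s t * ((1 - α) * h s t + h₁ s t - g₂ s t)
  g_per : ∀ t ∈ Icc 0 T, g 0 t = g S t
  h_per : ∀ t ∈ Icc 0 T, h 0 t = h S t
  h₁_per : ∀ t ∈ Icc 0 T, h₁ 0 t = h₁ S t
  h_bot : ∀ s ∈ Icc 0 S, h s 0 = c₁
  h_top : ∀ s ∈ Icc 0 S, h s T = c₂

namespace LogPolarFlow

variable {α S T c₁ c₂ : ℝ} (F : LogPolarFlow α S T c₁ c₂)

lemma zero_mem_S (F : LogPolarFlow α S T c₁ c₂) : (0 : ℝ) ∈ Icc 0 S := left_mem_Icc.2 F.S_pos.le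

lemma S_mem_S (F : LogPolarFlow α S T c₁ c₂) : S ∈ Icc 0 S := right_mem_Icc.2 F.S_pos.le

lemma zero_mem_T (F : LogPolarFlow α S T c₁ c₂) : (0 : ℝ) ∈ Icc 0 T := left_mem_Icc.2 F.T_pos.le

lemma T_mem_T (F : LogPolarFlow α S T c₁ c₂) : T ∈ Icc 0 T := right_mem_Icc.2 F.T_pos.le

lemma g_pos_or_neg : (∀ s ∈ Icc 0 S, ∀ t ∈ Icc 0 T, 0 < F.g s t) ∨
    ∀ s ∈ Icc 0 S, ∀ t ∈ Icc 0 T, F.g s t < 0 := by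
  have hpre : IsPreconnected (rect S T) := isPreconnected_Icc.prod isPreconnected_Icc
  rcases hpre.pos_or_neg F.g_data.contDiffOn.continuousOn
    (fun x hx => F.g_ne x.1 hx.1 x.2 hx.2) with h | h
  · exact Or.inl fun s hs t ht => h (s, t) ⟨hs, ht⟩
  · exact Or.inr fun s hs t ht => h (s, t) ⟨hs, ht⟩

/-- The first derivatives of the divergence equation. -/
lemma div_deriv {s t : ℝ} (hs : s ∈ Icc 0 S) (ht : t ∈ Icc 0 T) :
    F.g₁₁ s t + F.h₁₂ s t + (1 - α) * F.g₁ s t = 0 ∧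
      F.g₁₂ s t + F.h₂₂ s t + (1 - α) * F.g₂ s t = 0 :=
  ((F.g_data.partials₁.add F.h_data.partials₂).add
    (F.g_data.partials.const_mul (1 - α))).eq_zero F.S_pos F.T_pos F.div_eq hs ht

lemma g₂_per : ∀ t ∈ Icc 0 T, F.g₂ 0 t = F.g₂ S t :=
  F.g_data.partials.periodic_snd F.S_pos F.T_pos F.g_per

lemma g₁_per : ∀ t ∈ Icc 0 T, F.g₁ 0 t = F.g₁ S t := fun t ht => by
  have h1 := F.div_eq 0 F.zero_mem_S t ht
  have h2 := F.div_eq S F.S_mem_S t ht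
  have h3 := F.h_data.partials.periodic_snd F.S_pos F.T_pos F.h_per t ht
  rw [F.g_per t ht] at h1
  linarith

/-- `ψ` is a normalised stream function of the flow, divided by `r ^ (1 - α)`. -/
structure IsStream (ψ : ℝ → ℝ → ℝ) : Prop where
  partials : HasPartials S T ψ (fun s t => -F.h s t - (1 - α) * ψ s t) F.g
  continuousOn : ContinuousOn (fun x : ℝ × ℝ => ψ x.1 x.2) (rect S T)
  per : ∀ t ∈ Icc 0 T, ψ 0 t = ψ S t
  bot : ∀ s ∈ Icc 0 S, ψ s 0 = -c₁ / (1 - α)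
  top : ∀ s ∈ Icc 0 S, ψ s T = -c₂ / (1 - α)

lemma one_sub_ne (F : LogPolarFlow α S T c₁ c₂) : 1 - α ≠ 0 := sub_ne_zero.2 F.α_ne.symm

/-- On an edge with `h = c`, the equation `ψ_s = -c - (1-α)ψ` is a linear ODE in `s`, and `exp
((1-α)s)` is its integrating factor. -/
lemma exp_mul_stream_edge {ψ : ℝ → ℝ → ℝ}
    (hψ : HasPartials S T ψ (fun s t => -F.h s t - (1 - α) * ψ s t) F.g) {t c : ℝ}
    (ht : t ∈ Icc 0 T) (hc : ∀ s ∈ Icc 0 S, F.h s t = c) {s : ℝ} (hs : s ∈ Icc 0 S) :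
    exp ((1 - α) * s) * (ψ s t + c / (1 - α)) = ψ 0 t + c / (1 - α) := by
  have h := eq_left_of_hasDerivWithinAt_zero (a := 0) (b := S)
    (f := fun s => exp ((1 - α) * s) * (ψ s t + c / (1 - α))) (fun s hs => by
      have h1 : HasDerivAt (fun s => exp ((1 - α) * s)) (exp ((1 - α) * s) * ((1 - α) * 1)) s :=
        ((hasDerivAt_id s).const_mul _).exp
      have h2 := h1.hasDerivWithinAt.mul ((hψ s hs t ht).1.add_const (c / (1 - α)))
      refine h2.congr_deriv ?_
      beta_reduce
      rw [hc s hs]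
      have := F.one_sub_ne
      field_simp
      ring) s hs
  simpa using h

/-- `div_eq` says that `exp((1-α)s) (-h ds + g dt)` is closed. Its potential, normalised and
multiplied by `exp(-(1-α)s)`, is the stream function. -/
theorem exists_isStream : ∃ ψ, F.IsStream ψ := by
  have hexp : ∀ c s : ℝ, HasDerivAt (fun s => exp (c * s)) (c * exp (c * s)) s := fun c s => by
    simpa [mul_comm] using ((hasDerivAt_id s).const_mul c).exp
  have he := hasPartials_of_deriv (S := S) (T := T) (hexp (1 - α))
  have he' := hasPartials_of_deriv (S := S) (T := T) (hexp (-(1 - α)))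
  have hec : ContDiffOn ℝ 1 (fun x : ℝ × ℝ => exp ((1 - α) * x.1)) (rect S T) := by
    apply ContDiff.contDiffOn; fun_prop
  have hA := (he.mul F.h_data.partials).neg
  have hB := he.mul F.g_data.partials
  obtain ⟨Ψ, hΨ, hΨc⟩ := exists_potential F.S_pos F.T_pos
    (C := fun s t => -(exp ((1 - α) * s) * F.h₂ s t))
    (hec.mul (F.h_data.contDiffOn.of_le (by norm_num))).neg
    (hec.mul (F.g_data.contDiffOn.of_le (by norm_num)))
    (hA.congr (fun _ _ _ _ => rfl) (fun s hs t ht => by ring))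
    (hB.congr (fun s hs t ht => by linear_combination exp ((1 - α) * s) * F.div_eq s hs t ht)
      (fun _ _ _ _ => rfl))
  -- The additive constant that starts the ODE on the bottom edge at its equilibrium.
  set d := -c₁ / (1 - α) - Ψ 0 0
  set ψ : ℝ → ℝ → ℝ := fun s t => exp (-(1 - α) * s) * (Ψ s t + d)
  have hd : HasPartials S T (fun s t => Ψ s t + d) _ _ := fun s hs t ht =>
    ⟨(hΨ s hs t ht).1.add_const d, (hΨ s hs t ht).2.add_const d⟩
  have hee : ∀ s, exp (-(1 - α) * s) * exp ((1 - α) * s) = 1 := fun s => by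
    rw [← exp_add, exp_eq_one_iff]; ring
  have hψ : HasPartials S T ψ (fun s t => -F.h s t - (1 - α) * ψ s t) F.g := by
    refine (he'.mul hd).congr (fun s hs t ht => ?_) (fun s hs t ht => ?_)
    · simp only [ψ]
      linear_combination -F.h s t * hee s
    · linear_combination F.g s t * hee s
  have hbot : ∀ s ∈ Icc 0 S, ψ s 0 = -c₁ / (1 - α) := by
    intro s hs
    have h1 := F.exp_mul_stream_edge hψ F.zero_mem_T F.h_bot hs
    have h2 : ψ 0 0 + c₁ / (1 - α) = 0 := by simp [ψ, d]; ring
    rw [h2] at h1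
    have := (mul_eq_zero.1 h1).resolve_left (exp_pos _).ne'
    rw [neg_div]; linarith
  -- The difference vanishes at `t = 0` and has `t`-derivative `g 0 t - g S t = 0`.
  have hper : ∀ t ∈ Icc 0 T, ψ 0 t = ψ S t := by
    intro t ht
    have h := eq_left_of_hasDerivWithinAt_zero (a := 0) (b := T) (f := fun t => ψ 0 t - ψ S t)
      (fun t ht => by
        have := (hψ 0 F.zero_mem_S t ht).2.sub (hψ S F.S_mem_S t ht).2
        rwa [F.g_per t ht, sub_self] at this) t ht
    simp only [hbot 0 F.zero_mem_S, hbot S F.S_mem_S, sub_self] at h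
    linarith
  refine ⟨ψ, hψ, ?_, hper, hbot, ?_⟩
  · refine ContinuousOn.mul (Continuous.continuousOn (by fun_prop)) (hΨc.add continuousOn_const)
  · intro s hs
    -- On the top edge the value is not free: a periodic solution of the ODE must be the
    -- equilibrium, since `exp((1-α)S) ≠ 1`.
    have h1 := F.exp_mul_stream_edge hψ F.T_mem_T F.h_top F.S_mem_S
    rw [← hper T F.T_mem_T] at h1
    have h2 : exp ((1 - α) * S) ≠ 1 := by
      rw [Ne, exp_eq_one_iff]
      exact mul_ne_zero F.one_sub_ne F.S_pos.ne'
    have h3 : ψ 0 T + c₂ / (1 - α) = 0 := by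
      have : (exp ((1 - α) * S) - 1) * (ψ 0 T + c₂ / (1 - α)) = 0 := by linear_combination h1
      exact (mul_eq_zero.1 this).resolve_left (sub_ne_zero.2 h2)
    have h4 := F.exp_mul_stream_edge hψ F.T_mem_T F.h_top hs
    rw [h3] at h4
    have := (mul_eq_zero.1 h4).resolve_left (exp_pos _).ne'
    rw [neg_div]; linarith

/-- `ψ` is strictly monotone in `t` since `ψ_t = g` has a fixed sign, so its two edge values differ.
-/
theorem edge_constants_ne (F : LogPolarFlow α S T c₁ c₂) : c₁ ≠ c₂ := by
  obtain ⟨ψ, hψ⟩ := F.exists_isStream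
  rintro rfl
  have h : ψ 0 0 = ψ 0 T := by rw [hψ.bot 0 F.zero_mem_S, hψ.top 0 F.zero_mem_S]
  rcases F.g_pos_or_neg with hg | hg
  · exact (strictMonoOn_Icc_of_hasDerivWithinAt_pos
      (fun t ht => (hψ.partials 0 F.zero_mem_S t ht).2) (hg 0 F.zero_mem_S)
      F.zero_mem_T F.T_mem_T F.T_pos).ne h
  · exact (strictAntiOn_Icc_of_hasDerivWithinAt_neg
      (fun t ht => (hψ.partials 0 F.zero_mem_S t ht).2) (hg 0 F.zero_mem_S)
      F.zero_mem_T F.T_mem_T F.T_pos).ne h.symm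

/-- If the edge constants have the same sign, the stream function does not vanish. -/
lemma IsStream.ne_zero {ψ : ℝ → ℝ → ℝ} (hψ : F.IsStream ψ) (hc : 0 < c₁ * c₂) {s t : ℝ}
    (hs : s ∈ Icc 0 S) (ht : t ∈ Icc 0 T) : ψ s t ≠ 0 := by
  intro h0
  have hprod : 0 < ψ s 0 * ψ s T := by
    rw [hψ.bot s hs, hψ.top s hs]
    rw [div_mul_div_comm, neg_mul_neg]
    exact div_pos hc (mul_self_pos.2 F.one_sub_ne)
  rcases F.g_pos_or_neg with hg | hg
  · have hm := (strictMonoOn_Icc_of_hasDerivWithinAt_pos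
      (fun t ht => (hψ.partials s hs t ht).2) (hg s hs)).monotoneOn
    have h1 := hm F.zero_mem_T ht ht.1
    have h2 := hm ht F.T_mem_T ht.2
    simp only [h0] at h1 h2
    exact absurd (mul_nonpos_of_nonpos_of_nonneg h1 h2) (not_le.2 hprod)
  · have hm := (strictAntiOn_Icc_of_hasDerivWithinAt_neg
      (fun t ht => (hψ.partials s hs t ht).2) (hg s hs)).antitoneOn
    have h1 := hm F.zero_mem_T ht ht.1
    have h2 := hm ht F.T_mem_T ht.2
    simp only [h0] at h1 h2
    exact absurd (mul_nonpos_of_nonneg_of_nonpos h1 h2) (not_le.2 hprod)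

/-! ### Transport of the vorticity and its dependence on the stream function -/

/-- A solution of the transport equation satisfied by the rescaled vorticity. -/
structure IsTransported (E E₁ E₂ : ℝ → ℝ → ℝ) : Prop where
  partials : HasPartials S T E E₁ E₂
  continuousOn : ContinuousOn (fun x : ℝ × ℝ => E x.1 x.2) (rect S T)
  per : ∀ t ∈ Icc 0 T, E 0 t = E S t
  eq : ∀ s ∈ Icc 0 S, ∀ t ∈ Icc 0 T, F.g s t * E₁ s t + F.h s t * E₂ s t = (α + 1) * F.g s t * E s t

/-- After division by `g` the rate is `α + 1 > 0` and the transverse speed is `h / g`, which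
vanishes on an edge whose constant is zero. -/
theorem IsTransported.eq_zero_of_one_lt {E E₁ E₂ : ℝ → ℝ → ℝ} (hE : F.IsTransported E E₁ E₂)
    (hα : 1 < α) (hbot : (∀ s ∈ Icc 0 S, E s 0 = 0) ∨ c₁ = 0)
    (htop : (∀ s ∈ Icc 0 S, E s T = 0) ∨ c₂ = 0) :
    ∀ s ∈ Icc 0 S, ∀ t ∈ Icc 0 T, E s t = 0 := by
  refine transport_eq_zero F.S_pos F.T_pos (b := fun s t => F.h s t / F.g s t)
    (κ := α + 1) (by linarith) hE.continuousOn hE.partials hE.per (fun s hs t ht => ?_)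
    (fun s hs => hbot.imp (fun h => h s hs) fun h => by simp [(F.h_bot s hs).trans h])
    (fun s hs => htop.imp (fun h => h s hs) fun h => by simp [(F.h_top s hs).trans h])
  have := F.g_ne s hs t ht
  field_simp
  linear_combination hE.eq s hs t ht

/-- Along the transport `ψ` grows at rate `α - 1`, so `E * ψ ^ n` grows at rate `α + 1 + n(α - 1)`,
whose sign is at disposal. Integer exponents are used because `ψ` may be negative. -/
theorem IsTransported.eq_zero_of_mul_pos {E E₁ E₂ ψ : ℝ → ℝ → ℝ} (hE : F.IsTransported E E₁ E₂)
    (hψ : F.IsStream ψ) (hc : 0 < c₁ * c₂)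
    (h0 : (∀ s ∈ Icc 0 S, E s 0 = 0) ∨ ∀ s ∈ Icc 0 S, E s T = 0) :
    ∀ s ∈ Icc 0 S, ∀ t ∈ Icc 0 T, E s t = 0 := by
  have hne : ∀ s ∈ Icc 0 S, ∀ t ∈ Icc 0 T, ψ s t ≠ 0 := fun s hs t ht => hψ.ne_zero F hc hs ht
  have main : ∀ n : ℤ, α + 1 + n * (α - 1) ≠ 0 →
      (∀ s ∈ Icc 0 S, E s 0 = 0 ∨ 0 ≤ (α + 1 + n * (α - 1)) * (c₁ / F.g s 0)) →
      (∀ s ∈ Icc 0 S, E s T = 0 ∨ (α + 1 + n * (α - 1)) * (c₂ / F.g s T) ≤ 0) →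
      ∀ s ∈ Icc 0 S, ∀ t ∈ Icc 0 T, E s t = 0 := by
    intro n hn hb ht' s hs t ht
    have hpow := hψ.partials.comp (Φ := fun x => x ^ n)
      (d := fun s t => n * ψ s t ^ (n - 1))
      (fun s hs t ht => hasDerivAt_zpow n _ (Or.inl (hne s hs t ht)))
    have := transport_eq_zero F.S_pos F.T_pos (E := fun s t => E s t * ψ s t ^ n)
      (b := fun s t => F.h s t / F.g s t) hn
      (hE.continuousOn.mul (hψ.continuousOn.zpow₀ n fun x hx => Or.inl (hne x.1 hx.1 x.2 hx.2)))
      (hE.partials.mul hpow) (fun t ht => by rw [hE.per t ht, hψ.per t ht])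
      (fun s hs t ht => by
        have h1 := F.g_ne s hs t ht
        have h2 := hne s hs t ht
        rw [zpow_sub_one₀ h2]
        have h3 := hE.eq s hs t ht
        have h4 : E₁ s t + F.h s t / F.g s t * E₂ s t = (α + 1) * E s t := by
          field_simp
          linear_combination h3
        have h5 : n * (ψ s t ^ n * (ψ s t)⁻¹) * (-F.h s t - (1 - α) * ψ s t) +
            F.h s t / F.g s t * (n * (ψ s t ^ n * (ψ s t)⁻¹) * F.g s t) =
            n * (α - 1) * ψ s t ^ n := by
          have h6 : F.h s t / F.g s t * F.g s t = F.h s t := div_mul_cancel₀ _ h1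
          linear_combination n * (ψ s t ^ n * (ψ s t)⁻¹) * h6 +
            n * (α - 1) * ψ s t ^ n * inv_mul_cancel₀ h2
        linear_combination ψ s t ^ n * h4 + E s t * h5)
      (fun s hs => (hb s hs).imp (fun h => by simp [h]) fun h => by rwa [F.h_bot s hs])
      (fun s hs => (ht' s hs).imp (fun h => by simp [h]) fun h => by rwa [F.h_top s hs]) s hs t ht
    exact (mul_eq_zero.1 this).resolve_right (zpow_ne_zero _ (hne s hs t ht))
  have hα : α - 1 ≠ 0 := sub_ne_zero.2 F.α_ne
  obtain ⟨n, hn⟩ := exists_int_add_mul_pos (α + 1) hα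
  obtain ⟨m, hm⟩ := exists_int_add_mul_pos (-(α + 1)) (neg_ne_zero.2 hα)
  have hm' : α + 1 + m * (α - 1) < 0 := by linarith
  -- The transverse speed has the same sign on both edges: the flow enters through one and leaves
  -- through the other. The edge where `E` is not known to vanish dictates the choice between `n`
  -- and `m`.
  have hsign : (∀ s ∈ Icc 0 S, 0 ≤ c₁ / F.g s 0 ∧ 0 ≤ c₂ / F.g s T) ∨
      ∀ s ∈ Icc 0 S, c₁ / F.g s 0 ≤ 0 ∧ c₂ / F.g s T ≤ 0 := by
    rcases F.g_pos_or_neg with hg | hg <;> rcases mul_pos_iff.1 hc with ⟨h1, h2⟩ | ⟨h1, h2⟩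
    · exact Or.inl fun s hs => ⟨div_nonneg h1.le (hg s hs 0 F.zero_mem_T).le,
        div_nonneg h2.le (hg s hs T F.T_mem_T).le⟩
    · exact Or.inr fun s hs => ⟨div_nonpos_of_nonpos_of_nonneg h1.le (hg s hs 0 F.zero_mem_T).le,
        div_nonpos_of_nonpos_of_nonneg h2.le (hg s hs T F.T_mem_T).le⟩
    · exact Or.inr fun s hs => ⟨div_nonpos_of_nonneg_of_nonpos h1.le (hg s hs 0 F.zero_mem_T).le,
        div_nonpos_of_nonneg_of_nonpos h2.le (hg s hs T F.T_mem_T).le⟩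
    · exact Or.inl fun s hs => ⟨div_nonneg_of_nonpos h1.le (hg s hs 0 F.zero_mem_T).le,
        div_nonneg_of_nonpos h2.le (hg s hs T F.T_mem_T).le⟩
  rcases h0 with h0 | h0 <;> rcases hsign with hs | hs
  · exact main m hm'.ne (fun s h => Or.inl (h0 s h))
      fun s h => Or.inr (mul_nonpos_of_nonpos_of_nonneg hm'.le (hs s h).2)
  · exact main n hn.ne' (fun s h => Or.inl (h0 s h))
      fun s h => Or.inr (mul_nonpos_of_nonneg_of_nonpos hn.le (hs s h).2)
  · exact main n hn.ne' (fun s h => Or.inr (mul_nonneg hn.le (hs s h).1))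
      fun s h => Or.inl (h0 s h)
  · exact main m hm'.ne (fun s h => Or.inr (mul_nonneg_of_nonpos_of_nonpos hm'.le (hs s h).1))
      fun s h => Or.inl (h0 s h)

/-- The rescaled vorticity minus a function of the stream function is transported. -/
lemma isTransported_sub {ψ d : ℝ → ℝ → ℝ} {Φ : ℝ → ℝ} (hψ : F.IsStream ψ)
    (hd : ∀ s ∈ Icc 0 S, ∀ t ∈ Icc 0 T, HasDerivAt Φ (d s t) (ψ s t))
    (hd' : ∀ s ∈ Icc 0 S, ∀ t ∈ Icc 0 T,
      (1 - α) * ψ s t * d s t = -(α + 1) * Φ (ψ s t)) :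
    F.IsTransported (fun s t => (1 - α) * F.h s t + F.h₁ s t - F.g₂ s t - Φ (ψ s t))
      (fun s t => (1 - α) * F.h₁ s t + F.h₁₁ s t - F.g₁₂ s t -
        d s t * (-F.h s t - (1 - α) * ψ s t))
      (fun s t => (1 - α) * F.h₂ s t + F.h₁₂ s t - F.g₂₂ s t - d s t * F.g s t) where
  partials := (((F.h_data.partials.const_mul (1 - α)).add F.h_data.partials₁).sub
    F.g_data.partials₂).sub (hψ.partials.comp hd)
  continuousOn := by
    refine (((F.h_data.contDiffOn.continuousOn.const_mul (1 - α)).add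
      F.h_data.contDiffOn₁.continuousOn).sub F.g_data.contDiffOn₂.continuousOn).sub ?_
    intro x hx
    exact ContinuousAt.comp_continuousWithinAt (g := Φ) (f := fun x : ℝ × ℝ => ψ x.1 x.2)
      (hd x.1 hx.1 x.2 hx.2).continuousAt (hψ.continuousOn x hx)
  per t ht := by rw [F.h_per t ht, F.h₁_per t ht, F.g₂_per t ht, hψ.per t ht]
  eq s hs t ht := by
    linear_combination F.vorticity_eq s hs t ht + F.g s t * hd' s hs t ht

lemma h₁_bot {s : ℝ} (hs : s ∈ Icc 0 S) : F.h₁ s 0 = 0 :=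
  (uniqueDiffOn_Icc F.S_pos s hs).eq_deriv _ (F.h_data.partials s hs 0 F.zero_mem_T).1
    ((hasDerivWithinAt_const s _ c₁).congr F.h_bot (F.h_bot s hs))

lemma h₁_top {s : ℝ} (hs : s ∈ Icc 0 S) : F.h₁ s T = 0 :=
  (uniqueDiffOn_Icc F.S_pos s hs).eq_deriv _ (F.h_data.partials s hs T F.T_mem_T).1
    ((hasDerivWithinAt_const s _ c₂).congr F.h_top (F.h_top s hs))

/-- The angular derivative of `g` is constant on the edge `t = τ`. -/
def ConstOnEdge (τ : ℝ) : Prop := ∃ γ, ∀ s ∈ Icc 0 S, F.g₂ s τ = γ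

/-- The union of the four sets of additional conditions. -/
def AdditionalConditions : Prop :=
  (0 < c₁ * c₂ ∧ (F.ConstOnEdge 0 ∨ F.ConstOnEdge T)) ∨ (c₁ = 0 ∧ 1 < α ∧ F.ConstOnEdge T) ∨
    (c₂ = 0 ∧ 1 < α ∧ F.ConstOnEdge 0) ∨
      (c₁ * c₂ < 0 ∧ 1 < α ∧ F.ConstOnEdge 0 ∧ F.ConstOnEdge T)

/-- The rescaled vorticity is a function of the stream function, in differential form. -/
theorem vorticity_stream_relation (hF : F.AdditionalConditions) {ψ : ℝ → ℝ → ℝ}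
    (hψ : F.IsStream ψ) {s t : ℝ} (hs : s ∈ Icc 0 S) (ht : t ∈ Icc 0 T) :
    F.g s t * ((1 - α) * F.h₁ s t + F.h₁₁ s t - F.g₁₂ s t) =
      (-F.h s t - (1 - α) * ψ s t) * ((1 - α) * F.h₂ s t + F.h₁₂ s t - F.g₂₂ s t) := by
  set ν := (α + 1) / (α - 1)
  have hα : α - 1 ≠ 0 := sub_ne_zero.2 F.α_ne
  have hα' := F.one_sub_ne
  have hν1 : 1 < α → 1 < ν := fun h => by
    rw [one_lt_div (by linarith)]; linarith
  -- It suffices to get `W = Φ(ψ)` with `Φ` differentiable at the values of `ψ`: then `W_s = Φ'(ψ)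
  -- ψ_s` and `W_t = Φ'(ψ) g`, and eliminating `Φ'` gives the claim.
  suffices H : ∃ K K', (∀ s ∈ Icc 0 S, ∀ t ∈ Icc 0 T, ψ s t ≠ 0 ∨ 1 < ν) ∧
      ∀ E₁ E₂, F.IsTransported (fun s t => (1 - α) * F.h s t + F.h₁ s t - F.g₂ s t -
        signedPower ν K K' (ψ s t)) E₁ E₂ → ∀ s ∈ Icc 0 S, ∀ t ∈ Icc 0 T,
        (1 - α) * F.h s t + F.h₁ s t - F.g₂ s t - signedPower ν K K' (ψ s t) = 0 by
    obtain ⟨K, K', hne, H⟩ := H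
    -- `choose` needs a total function; off the rectangle the value `0` is a dummy.
    have hd : ∀ s t, ∃ d, s ∈ Icc 0 S → t ∈ Icc 0 T →
        HasDerivAt (signedPower ν K K') d (ψ s t) ∧
          ψ s t * d = ν * signedPower ν K K' (ψ s t) := fun s t => by
      by_cases h : s ∈ Icc 0 S ∧ t ∈ Icc 0 T
      · obtain ⟨d, hd⟩ := signedPower_hasDerivAt K K' (hne s h.1 t h.2)
        exact ⟨d, fun _ _ => hd⟩
      · exact ⟨0, fun h1 h2 => absurd ⟨h1, h2⟩ h⟩
    choose d hd using hd
    have hE := F.isTransported_sub (d := d) hψ (fun s hs t ht => (hd s t hs ht).1)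
      (fun s hs t ht => by
        have h1 := (hd s t hs ht).2
        have h2 : (1 - α) * ν = -(α + 1) := by simp only [ν]; field_simp; ring
        rw [← h2]
        linear_combination (1 - α) * h1)
    obtain ⟨h1, h2⟩ := hE.partials.eq_zero F.S_pos F.T_pos (H _ _ hE) hs ht
    linear_combination F.g s t * h1 - (-F.h s t - (1 - α) * ψ s t) * h2
  have hWbot : ∀ γ K K', (∀ s ∈ Icc 0 S, F.g₂ s 0 = γ) →
      signedPower ν K K' (-c₁ / (1 - α)) = (1 - α) * c₁ - γ → ∀ s ∈ Icc 0 S,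
      (1 - α) * F.h s 0 + F.h₁ s 0 - F.g₂ s 0 - signedPower ν K K' (ψ s 0) = 0 := by
    intro γ K K' h1 h2 s hs
    rw [F.h_bot s hs, F.h₁_bot hs, h1 s hs, hψ.bot s hs, h2]
    ring
  have hWtop : ∀ γ K K', (∀ s ∈ Icc 0 S, F.g₂ s T = γ) →
      signedPower ν K K' (-c₂ / (1 - α)) = (1 - α) * c₂ - γ → ∀ s ∈ Icc 0 S,
      (1 - α) * F.h s T + F.h₁ s T - F.g₂ s T - signedPower ν K K' (ψ s T) = 0 := by
    intro γ K K' h1 h2 s hs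
    rw [F.h_top s hs, F.h₁_top hs, h1 s hs, hψ.top s hs, h2]
    ring
  have hx1 : c₁ ≠ 0 → -c₁ / (1 - α) ≠ 0 := fun h => div_ne_zero (neg_ne_zero.2 h) hα'
  have hx2 : c₂ ≠ 0 → -c₂ / (1 - α) ≠ 0 := fun h => div_ne_zero (neg_ne_zero.2 h) hα'
  rcases hF with ⟨hc, ⟨γ, hγ⟩ | ⟨γ, hγ⟩⟩ | ⟨hc, h1, γ, hγ⟩ | ⟨hc, h1, γ, hγ⟩ |
    ⟨hc, h1, ⟨γ, hγ⟩, γ', hγ'⟩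
  · obtain ⟨K, K', hK⟩ := exists_signedPower_eq (ν := ν) (hx1 (left_ne_zero_of_mul hc.ne'))
      ((1 - α) * c₁ - γ)
    exact ⟨K, K', fun s hs t ht => Or.inl (hψ.ne_zero F hc hs ht), fun E₁ E₂ hE =>
      hE.eq_zero_of_mul_pos F hψ hc (Or.inl (hWbot γ K K' hγ hK))⟩
  · obtain ⟨K, K', hK⟩ := exists_signedPower_eq (ν := ν) (hx2 (right_ne_zero_of_mul hc.ne'))
      ((1 - α) * c₂ - γ)
    exact ⟨K, K', fun s hs t ht => Or.inl (hψ.ne_zero F hc hs ht), fun E₁ E₂ hE =>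
      hE.eq_zero_of_mul_pos F hψ hc (Or.inr (hWtop γ K K' hγ hK))⟩
  · obtain ⟨K, K', hK⟩ := exists_signedPower_eq (ν := ν)
      -- Here `c₁ = 0`, so `c₂ ≠ 0` because the edge constants differ.
      (hx2 fun h => F.edge_constants_ne (hc.trans h.symm)) ((1 - α) * c₂ - γ)
    exact ⟨K, K', fun s hs t ht => Or.inr (hν1 h1), fun E₁ E₂ hE =>
      hE.eq_zero_of_one_lt F h1 (Or.inr hc) (Or.inl (hWtop γ K K' hγ hK))⟩
  · obtain ⟨K, K', hK⟩ := exists_signedPower_eq (ν := ν)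
      (hx1 fun h => F.edge_constants_ne (h.trans hc.symm)) ((1 - α) * c₁ - γ)
    exact ⟨K, K', fun s hs t ht => Or.inr (hν1 h1), fun E₁ E₂ hE =>
      hE.eq_zero_of_one_lt F h1 (Or.inl (hWbot γ K K' hγ hK)) (Or.inr hc)⟩
  · have hneg : -c₁ / (1 - α) * (-c₂ / (1 - α)) < 0 := by
      rw [div_mul_div_comm, neg_mul_neg]
      exact div_neg_of_neg_of_pos hc (mul_self_pos.2 hα')
    obtain ⟨K, K', hK, hK'⟩ := exists_signedPower_eq_eq (ν := ν)
      (by linarith [hν1 h1]) hneg ((1 - α) * c₁ - γ) ((1 - α) * c₂ - γ')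
    exact ⟨K, K', fun s hs t ht => Or.inr (hν1 h1), fun E₁ E₂ hE =>
      hE.eq_zero_of_one_lt F h1 (Or.inl (hWbot γ K K' hγ hK)) (Or.inl (hWtop γ' K K' hγ' hK'))⟩

/-- The quotient of the derivatives of the stream function solves an elliptic equation, hence it
vanishes. -/
theorem stream_deriv_eq_zero (hF : F.AdditionalConditions) {ψ : ℝ → ℝ → ℝ}
    (hψ : F.IsStream ψ) : ∀ s ∈ Icc 0 S, ∀ t ∈ Icc 0 T, -F.h s t - (1 - α) * ψ s t = 0 := by
  -- `χ` is `ψ_s`; its `t`-derivative is `g₁` by the divergence equation.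
  set χ : ℝ → ℝ → ℝ := fun s t => -F.h s t - (1 - α) * ψ s t
  have hα' := F.one_sub_ne
  have hχ : HasPartials S T χ (fun s t => -F.h₁ s t - (1 - α) * χ s t) F.g₁ :=
    (F.h_data.partials.neg.sub (hψ.partials.const_mul (1 - α))).congr (fun _ _ _ _ => rfl)
      fun s hs t ht => by linear_combination -F.div_eq s hs t ht
  have hχ₁ : HasPartials S T (fun s t => -F.h₁ s t - (1 - α) * χ s t) _ _ :=
    F.h_data.partials₁.neg.sub (hχ.const_mul (1 - α))
  have hχ₂ := F.g_data.partials₁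
  have hg := F.g_data.partials
  have hne := F.g_ne
  have hne2 : ∀ s ∈ Icc 0 S, ∀ t ∈ Icc 0 T, F.g s t * F.g s t ≠ 0 := fun s hs t ht =>
    mul_ne_zero (hne s hs t ht) (hne s hs t ht)
  set ρ : ℝ → ℝ → ℝ := fun s t => χ s t / F.g s t
  have hρ : HasPartials S T ρ _ _ := (hχ.div hg hne).congr
    (F₁' := fun s t => ((-F.h₁ s t - (1 - α) * χ s t) * F.g s t - χ s t * F.g₁ s t) /
      (F.g s t * F.g s t))
    (F₂' := fun s t => (F.g₁ s t * F.g s t - χ s t * F.g₂ s t) / (F.g s t * F.g s t))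
    (fun s hs t ht => by rw [sq]) (fun s hs t ht => by rw [sq])
  have hρ₁ := ((hχ₁.mul hg).sub (hχ.mul F.g_data.partials₁)).div (hg.mul hg) hne2
  have hρ₂ := ((hχ₂.mul hg).sub (hχ.mul F.g_data.partials₂)).div (hg.mul hg) hne2
  have hρc : ContinuousOn (fun x : ℝ × ℝ => ρ x.1 x.2) (rect S T) :=
    (F.h_data.contDiffOn.continuousOn.neg.sub (hψ.continuousOn.const_mul (1 - α))).div
      F.g_data.contDiffOn.continuousOn fun x hx => hne x.1 hx.1 x.2 hx.2
  obtain ⟨M, hM⟩ := (isCompact_Icc.prod isCompact_Icc).exists_bound_of_continuousOn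
    (s := rect S T) (f := fun x : ℝ × ℝ => 2 * F.g₂ x.1 x.2 / F.g x.1 x.2)
    ((F.g_data.contDiffOn₂.continuousOn.const_mul 2).div F.g_data.contDiffOn.continuousOn
      fun x hx => hne x.1 hx.1 x.2 hx.2)
  have hχper : ∀ t ∈ Icc 0 T, χ 0 t = χ S t := fun t ht => by
    simp only [χ, F.h_per t ht, hψ.per t ht]
  have hper : ∀ t ∈ Icc 0 T, ρ 0 t = ρ S t := fun t ht => by
    simp only [ρ, hχper t ht, F.g_per t ht]
  have hbot : ∀ s ∈ Icc 0 S, ρ s 0 = 0 := fun s hs => by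
    simp only [ρ, χ, F.h_bot s hs, hψ.bot s hs]
    field_simp
    simp
  have htop : ∀ s ∈ Icc 0 S, ρ s T = 0 := fun s hs => by
    simp only [ρ, χ, F.h_top s hs, hψ.top s hs]
    field_simp
    simp
  have h0 := elliptic_eq_zero F.S_pos F.T_pos (M := M)
    (p := fun s t => 2 * F.g₁ s t / F.g s t + 2 * (1 - α)) (q := fun s t => 2 * F.g₂ s t / F.g s t)
    hρc hρ hρ₁ hρ₂ hper
    (fun t ht => by rw [F.h₁_per t ht, hχper t ht, F.g_per t ht, F.g₁_per t ht])
    (fun s hs t ht => hM (s, t) (mk_mem_prod hs ht))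
    (fun s hs t ht => by
      have h1 := F.vorticity_stream_relation hF hψ hs ht
      change _ = χ s t * _ at h1
      -- This is `g Δχ - χ Δg + 2(1-α)(g χ_s - χ g_s) = 0`, the zeroth order terms of the two
      -- linearised equations having cancelled. Division by `g ^ 2` turns it into the equation for
      -- `ρ`.
      have h2 : F.g s t * ((-F.h₁₁ s t - (1 - α) * (-F.h₁ s t - (1 - α) * χ s t)) + F.g₁₂ s t) -
          χ s t * (F.g₁₁ s t + F.g₂₂ s t) +
          2 * (1 - α) * (F.g s t * (-F.h₁ s t - (1 - α) * χ s t) - χ s t * F.g₁ s t) = 0 := by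
        linear_combination -h1 - χ s t * ((1 - α) * F.div_eq s hs t ht + (F.div_deriv hs ht).1)
      have h3 := hne s hs t ht
      rw [← zero_div (F.g s t ^ 2), ← h2]
      field_simp
      ring)
    hbot htop
  intro s hs t ht
  exact (div_eq_zero_iff.1 (h0 s hs t ht)).resolve_right (hne s hs t ht)

/-- Under the additional conditions the flow does not depend on `s`. -/
theorem eq_left (hF : F.AdditionalConditions) {s t : ℝ} (hs : s ∈ Icc 0 S) (ht : t ∈ Icc 0 T) :
    F.g s t = F.g 0 t ∧ F.h s t = F.h 0 t := by
  obtain ⟨ψ, hψ⟩ := F.exists_isStream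
  have hχ := F.stream_deriv_eq_zero hF hψ
  have hψ0 : ∀ t ∈ Icc 0 T, ∀ s ∈ Icc 0 S, ψ s t = ψ 0 t := fun t ht =>
    eq_left_of_hasDerivWithinAt_zero fun s hs => by
      exact (hψ.partials s hs t ht).1.congr_deriv (hχ s hs t ht)
  constructor
  · exact (uniqueDiffOn_Icc F.T_pos t ht).eq_deriv _ (hψ.partials s hs t ht).2
      ((hψ.partials 0 F.zero_mem_S t ht).2.congr (fun t ht => hψ0 t ht s hs) (hψ0 t ht s hs))
  · have h1 := hχ s hs t ht
    have h2 := hχ 0 F.zero_mem_S t ht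
    rw [hψ0 t ht s hs] at h1
    linarith

end LogPolarFlow

/-! ### The polar frame and logarithmic polar coordinates -/

section PolarFrame

lemma inner_plane (x y : Plane) : inner ℝ x y = x 0 * y 0 + x 1 * y 1 := by
  simp [PiLp.inner_apply, Fin.sum_univ_two, mul_comm]

@[simp] lemma eR_zero (t : ℝ) : eR t 0 = cos t := by simp [eR]

@[simp] lemma eR_one (t : ℝ) : eR t 1 = sin t := by simp [eR]

@[simp] lemma eTheta_zero (t : ℝ) : eTheta t 0 = -sin t := by simp [eTheta]

@[simp] lemma eTheta_one (t : ℝ) : eTheta t 1 = cos t := by simp [eTheta]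

lemma contDiff_eR : ContDiff ℝ 2 eR := by
  rw [contDiff_euclidean]
  intro i
  fin_cases i
  · simpa using contDiff_cos
  · simpa using contDiff_sin

lemma contDiff_eTheta : ContDiff ℝ 2 eTheta := by
  rw [contDiff_euclidean]
  intro i
  fin_cases i
  · simpa using contDiff_sin.neg
  · simpa using contDiff_cos

lemma hasDerivAt_eR (t : ℝ) : HasDerivAt eR (eTheta t) t := by
  -- `eR t = cos t • eR 0 + sin t • eTheta 0`, with the fixed frame at angle `0`.
  have h := ((hasDerivAt_cos t).smul_const (eR 0)).add ((hasDerivAt_sin t).smul_const (eTheta 0))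
  refine (h.congr_of_eventuallyEq (Eventually.of_forall fun y => ?_)).congr_deriv ?_
  · ext i; fin_cases i <;> simp
  · ext i; fin_cases i <;> simp

lemma hasDerivAt_eTheta (t : ℝ) : HasDerivAt eTheta (-eR t) t := by
  have h := ((hasDerivAt_cos t).smul_const (eTheta 0)).sub ((hasDerivAt_sin t).smul_const (eR 0))
  refine (h.congr_of_eventuallyEq (Eventually.of_forall fun y => ?_)).congr_deriv ?_
  · ext i; fin_cases i <;> simp
  · ext i; fin_cases i <;> simp

/-- The decomposition of a vector in the polar frame. -/
lemma eq_polar_components (w : Plane) (t : ℝ) :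
    w = inner ℝ w (eR t) • eR t + inner ℝ w (eTheta t) • eTheta t := by
  have h := sin_sq_add_cos_sq t
  ext i
  fin_cases i
  · simp [inner_plane]; linear_combination -w 0 * h
  · simp [inner_plane]; linear_combination -w 1 * h

/-- The divergence is the trace in the polar frame. -/
lemma divergence_eq_polar (u : Plane → Plane) (x : Plane) (t : ℝ) :
    divergence u x = inner ℝ (fderiv ℝ u x (eR t)) (eR t) +
      inner ℝ (fderiv ℝ u x (eTheta t)) (eTheta t) := by
  set L := fderiv ℝ u x
  set e₀ : Plane := EuclideanSpace.single 0 1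
  set e₁ : Plane := EuclideanSpace.single 1 1
  have h1 : eR t = cos t • e₀ + sin t • e₁ := by ext i; fin_cases i <;> simp [e₀, e₁]
  have h2 : eTheta t = -sin t • e₀ + cos t • e₁ := by ext i; fin_cases i <;> simp [e₀, e₁]
  have h := sin_sq_add_cos_sq t
  have h3 : divergence u x = L e₀ 0 + L e₁ 1 := by simp [divergence, Fin.sum_univ_two, L, e₀, e₁]
  rw [h3, inner_plane, inner_plane, eR_zero, eR_one, eTheta_zero, eTheta_one, h1, h2]
  simp only [map_add, map_smul, PiLp.add_apply, PiLp.smul_apply, smul_eq_mul]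
  linear_combination -(L e₀ 0 + L e₁ 1) * h

/-- The plane in logarithmic polar coordinates. -/
noncomputable def logPolar (x : ℝ × ℝ) : Plane := polarPt (exp x.1) x.2

lemma contDiff_logPolar : ContDiff ℝ 2 logPolar :=
  (contDiff_exp.comp contDiff_fst).smul (contDiff_eR.comp contDiff_snd)

lemma hasDerivAt_logPolar_fst (s t : ℝ) :
    HasDerivAt (fun s => logPolar (s, t)) (exp s • eR t) s :=
  (hasDerivAt_exp s).smul_const (eR t)

lemma hasDerivAt_logPolar_snd (s t : ℝ) :
    HasDerivAt (fun t => logPolar (s, t)) (exp s • eTheta t) t :=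
  (hasDerivAt_eR t).const_smul (exp s)

variable {θ₀ : ℝ}

lemma exp_mem_Icc {s : ℝ} (hs : s ∈ Icc 0 (log 2)) : exp s ∈ Icc (1 : ℝ) 2 :=
  ⟨one_le_exp hs.1, by simpa [exp_log] using exp_le_exp.2 hs.2⟩

lemma log_mem_Icc {r : ℝ} (hr : r ∈ Icc (1 : ℝ) 2) : log r ∈ Icc 0 (log 2) :=
  ⟨log_nonneg hr.1, log_le_log (by linarith [hr.1]) hr.2⟩

lemma logPolar_mem_sector {s t : ℝ} (hs : s ∈ Ioo 0 (log 2)) (ht : t ∈ Ioo 0 θ₀) :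
    logPolar (s, t) ∈ sector 1 2 θ₀ := by
  refine ⟨exp s, t, one_lt_exp_iff.2 hs.1, ?_, ht.1, ht.2, rfl⟩
  simpa [exp_log] using exp_lt_exp.2 hs.2

lemma mapsTo_logPolar (hθ₀ : 0 < θ₀) :
    MapsTo logPolar (rect (log 2) θ₀) (closure (sector 1 2 θ₀)) := by
  have h : MapsTo logPolar (Ioo 0 (log 2) ×ˢ Ioo 0 θ₀) (sector 1 2 θ₀) :=
    fun x hx => logPolar_mem_sector hx.1 hx.2
  have := h.closure contDiff_logPolar.continuous
  rwa [closure_prod_eq, closure_Ioo (log_pos one_lt_two).ne, closure_Ioo hθ₀.ne] at this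

/-- The image of the closed rectangle is compact, hence closed, and contains the sector. -/
lemma exists_polar_of_mem_closure {x : Plane} (hx : x ∈ closure (sector 1 2 θ₀)) :
    ∃ r ∈ Icc (1 : ℝ) 2, ∃ t ∈ Icc 0 θ₀, x = polarPt r t := by
  have hcl : IsClosed (logPolar '' rect (log 2) θ₀) :=
    ((isCompact_Icc.prod isCompact_Icc).image contDiff_logPolar.continuous).isClosed
  have hsub : sector 1 2 θ₀ ⊆ logPolar '' rect (log 2) θ₀ := by
    rintro _ ⟨r, t, h1, h2, h3, h4, rfl⟩
    refine ⟨(log r, t), ⟨log_mem_Icc ⟨h1.le, h2.le⟩, h3.le, h4.le⟩, ?_⟩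
    simp [logPolar, exp_log (zero_lt_one.trans h1)]
  obtain ⟨⟨s, t⟩, ⟨hs, ht⟩, rfl⟩ := closure_minimal hsub hcl hx
  exact ⟨exp s, exp_mem_Icc hs, t, ht, rfl⟩

/-- Polar coordinates with positive radius and angle in an interval shorter than `2π`
are unique. -/
lemma polarPt_injective (hθ₀' : θ₀ < 2 * π) {r r' t t' : ℝ} (hr : 0 < r) (hr' : 0 < r')
    (ht : t ∈ Icc 0 θ₀) (ht' : t' ∈ Icc 0 θ₀) (h : polarPt r t = polarPt r' t') :
    r = r' ∧ t = t' := by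
  have h0 : r * cos t = r' * cos t' := by simpa [polarPt] using congrArg (fun x : Plane => x 0) h
  have h1 : r * sin t = r' * sin t' := by simpa [polarPt] using congrArg (fun x : Plane => x 1) h
  have hsq : r ^ 2 = r' ^ 2 := by
    linear_combination (r * cos t + r' * cos t') * h0 + (r * sin t + r' * sin t') * h1 -
      r ^ 2 * sin_sq_add_cos_sq t + r' ^ 2 * sin_sq_add_cos_sq t'
  have hrr : r = r' := (pow_left_inj₀ hr.le hr'.le two_ne_zero).1 hsq
  subst hrr
  refine ⟨rfl, ?_⟩
  have hc := mul_left_cancel₀ hr.ne' h0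
  have hs := mul_left_cancel₀ hr.ne' h1
  have hcos : cos (t - t') = 1 := by
    rw [cos_sub, hc, hs]; linear_combination sin_sq_add_cos_sq t'
  have := (cos_eq_one_iff_of_lt_of_lt (by linarith [ht.1, ht'.2]) (by linarith [ht.2, ht'.1])).1
    hcos
  linarith

end PolarFrame

/-! ### The Euler equations in polar components -/

section Derivatives

variable {θ₀ : ℝ} {u : Plane → Plane} {P : Plane → ℝ}

lemma hasDerivAt_radialComp {s t : ℝ} (hu : DifferentiableAt ℝ u (logPolar (s, t))) :
    HasDerivAt (fun s => radialComp u (exp s) t)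
        (exp s * inner ℝ (fderiv ℝ u (logPolar (s, t)) (eR t)) (eR t)) s ∧
      HasDerivAt (fun t => radialComp u (exp s) t)
        (exp s * inner ℝ (fderiv ℝ u (logPolar (s, t)) (eTheta t)) (eR t) +
          angularComp u (exp s) t) t := by
  constructor
  · have h := (hu.hasFDerivAt.comp_hasDerivAt s (hasDerivAt_logPolar_fst s t)).inner ℝ
      (hasDerivAt_const s (eR t))
    refine h.congr_deriv ?_
    simp [inner_smul_left]
  · have h := (hu.hasFDerivAt.comp_hasDerivAt t (hasDerivAt_logPolar_snd s t)).inner ℝ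
      (hasDerivAt_eR t)
    refine h.congr_deriv ?_
    simp [inner_smul_left, angularComp, logPolar, add_comm]

lemma hasDerivAt_angularComp {s t : ℝ} (hu : DifferentiableAt ℝ u (logPolar (s, t))) :
    HasDerivAt (fun s => angularComp u (exp s) t)
        (exp s * inner ℝ (fderiv ℝ u (logPolar (s, t)) (eR t)) (eTheta t)) s ∧
      HasDerivAt (fun t => angularComp u (exp s) t)
        (exp s * inner ℝ (fderiv ℝ u (logPolar (s, t)) (eTheta t)) (eTheta t) -
          radialComp u (exp s) t) t := by
  constructor
  · have h := (hu.hasFDerivAt.comp_hasDerivAt s (hasDerivAt_logPolar_fst s t)).inner ℝ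
      (hasDerivAt_const s (eTheta t))
    refine h.congr_deriv ?_
    simp [inner_smul_left]
  · have h := (hu.hasFDerivAt.comp_hasDerivAt t (hasDerivAt_logPolar_snd s t)).inner ℝ
      (hasDerivAt_eTheta t)
    refine h.congr_deriv ?_
    simp [inner_smul_left, radialComp, logPolar, sub_eq_add_neg, add_comm]

lemma hasFDerivAt_pressure {s t : ℝ} (hP : DifferentiableAt ℝ P (logPolar (s, t))) :
    HasFDerivAt (fun x => P (logPolar x))
      (oneForm (exp s * inner ℝ (gradient P (logPolar (s, t))) (eR t))
        (exp s * inner ℝ (gradient P (logPolar (s, t))) (eTheta t))) (s, t) := by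
  have hg : ∀ v, inner ℝ (gradient P (logPolar (s, t))) v = fderiv ℝ P (logPolar (s, t)) v :=
    fun v => by rw [gradient, InnerProductSpace.toDual_symm_apply]
  have hpol : DifferentiableAt ℝ logPolar (s, t) :=
    contDiff_logPolar.contDiffAt.differentiableAt (by norm_num)
  have h := (hP.comp (s, t) hpol).hasFDerivAt
  rw [eq_oneForm (fderiv ℝ _ _)] at h
  have h1 : HasDerivAt (fun s => logPolar (s, t)) (fderiv ℝ logPolar (s, t) (1, 0)) s :=
    hpol.hasFDerivAt.comp_hasDerivAt (f := fun s => (s, t)) s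
      ((hasDerivAt_id s).prodMk (hasDerivAt_const s t))
  have h2 : HasDerivAt (fun t => logPolar (s, t)) (fderiv ℝ logPolar (s, t) (0, 1)) t :=
    hpol.hasFDerivAt.comp_hasDerivAt (f := fun t => (s, t)) t
      ((hasDerivAt_const t s).prodMk (hasDerivAt_id t))
  rw [fderiv_comp _ hP hpol] at h
  simp only [ContinuousLinearMap.comp_apply, h1.unique (hasDerivAt_logPolar_fst s t),
    h2.unique (hasDerivAt_logPolar_snd s t), ← hg, inner_smul_right] at h
  exact h

/-- The Euler equations in the polar frame. -/
lemma IsEulerSolution.polar (hE : IsEulerSolution (sector 1 2 θ₀) u P) {s t : ℝ}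
    (hs : s ∈ Ioo 0 (log 2)) (ht : t ∈ Ioo 0 θ₀) {U₁ U₂ V₁ V₂ : ℝ}
    (hU₁ : HasDerivAt (fun s => radialComp u (exp s) t) U₁ s)
    (hU₂ : HasDerivAt (fun t => radialComp u (exp s) t) U₂ t)
    (hV₁ : HasDerivAt (fun s => angularComp u (exp s) t) V₁ s)
    (hV₂ : HasDerivAt (fun t => angularComp u (exp s) t) V₂ t) :
    U₁ + V₂ + radialComp u (exp s) t = 0 ∧
      HasFDerivAt (fun x => P (logPolar x))
        (oneForm
          (-(radialComp u (exp s) t * U₁ +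
            angularComp u (exp s) t * (U₂ - angularComp u (exp s) t)))
          (-(radialComp u (exp s) t * V₁ +
            angularComp u (exp s) t * (V₂ + radialComp u (exp s) t)))) (s, t) := by
  have hx := logPolar_mem_sector hs ht
  have hu := hE.differentiable_velocity _ hx
  have hdiv := hE.incompressible _ hx
  have hP := hasFDerivAt_pressure (hE.differentiable_pressure _ hx)
  have hm := hE.momentum _ hx
  rw [divergence_eq_polar u _ t] at hdiv
  have e1 := hU₁.unique (hasDerivAt_radialComp hu).1
  have e2 := hU₂.unique (hasDerivAt_radialComp hu).2
  have e3 := hV₁.unique (hasDerivAt_angularComp hu).1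
  have e4 := hV₂.unique (hasDerivAt_angularComp hu).2
  have hw : u (logPolar (s, t)) = radialComp u (exp s) t • eR t +
      angularComp u (exp s) t • eTheta t := eq_polar_components _ t
  have hgrad : gradient P (logPolar (s, t)) =
      -fderiv ℝ u (logPolar (s, t)) (u (logPolar (s, t))) := by rw [hm, neg_neg]
  rw [hgrad, hw] at hP
  simp only [map_add, map_smul, inner_neg_left, inner_add_left, inner_smul_left,
    conj_trivial] at hP
  refine ⟨by rw [e1, e4]; linear_combination exp s * hdiv, ?_⟩
  convert hP using 2
  · rw [e1, e2]; ring
  · rw [e3, e4]; ring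

end Derivatives

/-! ### From the boundary value problem to a flow on the rectangle -/

section Flow

variable {α θ₀ c₁ c₂ : ℝ} {u : Plane → Plane} {P : Plane → ℝ}

/-- `r ^ α u_r` in logarithmic polar coordinates. -/
noncomputable def scaledRadial (α : ℝ) (u : Plane → Plane) (s t : ℝ) : ℝ := exp (α * s) * radialComp u (exp s) t

/-- `r ^ α u_θ` in logarithmic polar coordinates. -/
noncomputable def scaledAngular (α : ℝ) (u : Plane → Plane) (s t : ℝ) : ℝ :=
  exp (α * s) * angularComp u (exp s) t

lemma contDiffOn_scaledRadial (hθ₀ : 0 < θ₀)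
    (hu : ContDiffOn ℝ 2 u (closure (sector 1 2 θ₀))) :
    ContDiffOn ℝ 2 (fun x : ℝ × ℝ => scaledRadial α u x.1 x.2) (rect (log 2) θ₀) := by
  have h := hu.comp contDiff_logPolar.contDiffOn (mapsTo_logPolar hθ₀)
  exact (ContDiff.contDiffOn (by fun_prop)).mul
    (h.inner ℝ (contDiff_eR.comp contDiff_snd).contDiffOn)

lemma contDiffOn_scaledAngular (hθ₀ : 0 < θ₀)
    (hu : ContDiffOn ℝ 2 u (closure (sector 1 2 θ₀))) :
    ContDiffOn ℝ 2 (fun x : ℝ × ℝ => scaledAngular α u x.1 x.2) (rect (log 2) θ₀) := by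
  have h := hu.comp contDiff_logPolar.contDiffOn (mapsTo_logPolar hθ₀)
  exact (ContDiff.contDiffOn (by fun_prop)).mul
    (h.inner ℝ (contDiff_eTheta.comp contDiff_snd).contDiffOn)

lemma exp_log_two : exp (log 2) = 2 := exp_log two_pos

lemma exp_mul_log_two (α : ℝ) : exp (α * log 2) = 2 ^ α := by
  rw [rpow_def_of_pos two_pos, mul_comm]

lemma exp_mul_eq_rpow (α s : ℝ) : exp (α * s) = exp s ^ α := by
  rw [← exp_mul, mul_comm]

end Flow

section Flow

variable {α θ₀ c₁ c₂ : ℝ} {u : Plane → Plane} {P : Plane → ℝ}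

lemma radialComp_eq (s t : ℝ) :
    radialComp u (exp s) t = exp (-α * s) * scaledRadial α u s t := by
  rw [scaledRadial, ← mul_assoc, ← exp_add]; simp

lemma angularComp_eq (s t : ℝ) :
    angularComp u (exp s) t = exp (-α * s) * scaledAngular α u s t := by
  rw [scaledAngular, ← mul_assoc, ← exp_add]; simp

lemma ArcCondition.components (harc : ArcCondition α θ₀ u) {t : ℝ} (ht : t ∈ Icc 0 θ₀) :
    scaledRadial α u 0 t = scaledRadial α u (log 2) t ∧
      scaledAngular α u 0 t = scaledAngular α u (log 2) t := by
  have h := (harc t ht).1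
  simp only [scaledRadial, scaledAngular, radialComp, angularComp, exp_log_two, exp_mul_log_two,
    exp_zero, mul_zero, one_mul, h, inner_smul_left, conj_trivial, and_self]

/-- The derivative of the angular component in `r`, in terms of the logarithmic coordinate. -/
lemma hasDerivWithinAt_angularComp {t r d : ℝ} (hr : r ∈ Icc (1 : ℝ) 2)
    (h : HasDerivWithinAt (fun s => scaledAngular α u s t) d (Icc 0 (log 2)) (log r)) :
    HasDerivWithinAt (fun r => angularComp u r t)
      (r ^ (-α - 1) * (d - α * scaledAngular α u (log r) t)) (Icc 1 2) r := by
  have hr0 : 0 < r := zero_lt_one.trans_le hr.1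
  have h1 := h.comp r (hasDerivAt_log hr0.ne').hasDerivWithinAt (fun x hx => log_mem_Icc hx)
  have h2 := ((hasDerivAt_rpow_const (p := -α) (Or.inl hr0.ne')).hasDerivWithinAt
    (s := Icc 1 2)).mul h1
  have key : ∀ x ∈ Icc (1 : ℝ) 2, angularComp u x t =
      x ^ (-α) * scaledAngular α u (log x) t := by
    intro x hx
    have hx0 : 0 < x := zero_lt_one.trans_le hx.1
    have := angularComp_eq (α := α) (u := u) (log x) t
    rwa [exp_log hx0, exp_mul_eq_rpow, exp_log hx0] at this
  refine (h2.congr key (key r hr)).congr_deriv ?_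
  rw [rpow_sub_one hr0.ne']
  simp only [Function.comp_apply]
  field_simp
  ring

/-- The factor `2 ^ (α + 1)` cancels `r ^ (-α - 1)` at `r = 2`, and the undifferentiated terms agree
by periodicity of the scaled component. -/
lemma ArcCondition.deriv_eq (harc : ArcCondition α θ₀ u) {t d d' : ℝ} (ht : t ∈ Icc 0 θ₀)
    (h : HasDerivWithinAt (fun s => scaledAngular α u s t) d (Icc 0 (log 2)) 0)
    (h' : HasDerivWithinAt (fun s => scaledAngular α u s t) d' (Icc 0 (log 2)) (log 2)) :
    d = d' := by
  have hU := uniqueDiffOn_Icc (one_lt_two (α := ℝ))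
  have h1 := hasDerivWithinAt_angularComp (r := 1) ⟨le_rfl, one_le_two⟩ (by simpa using h)
  have h2 := hasDerivWithinAt_angularComp (r := 2) ⟨one_le_two, le_rfl⟩ h'
  have h3 := (harc t ht).2
  rw [h1.derivWithin (hU 1 ⟨le_rfl, one_le_two⟩), h2.derivWithin (hU 2 ⟨one_le_two, le_rfl⟩),
    log_one, (harc.components ht).2, one_rpow, ← mul_assoc, ← rpow_add two_pos] at h3
  norm_num at h3
  exact h3

/-- The pressure gradient in logarithmic polar coordinates. -/
noncomputable def pressureForm (α g g₁ g₂ h h₁ h₂ s : ℝ) : ℝ × ℝ →L[ℝ] ℝ :=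
  oneForm (-(exp (-(2 * α) * s) * (g * (g₁ - α * g) + h * g₂ - h ^ 2)))
    (-(exp (-(2 * α) * s) * (g * (h₁ - α * h) + h * (h₂ + g))))

/-- The Euler equations for the scaled components. -/
lemma IsEulerSolution.scaled (hE : IsEulerSolution (sector 1 2 θ₀) u P)
    {g₁ g₂ h₁ h₂ : ℝ → ℝ → ℝ}
    (hg : HasPartials (log 2) θ₀ (scaledRadial α u) g₁ g₂)
    (hh : HasPartials (log 2) θ₀ (scaledAngular α u) h₁ h₂) {s t : ℝ}
    (hs : s ∈ Ioo 0 (log 2)) (ht : t ∈ Ioo 0 θ₀) :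
    g₁ s t + h₂ s t + (1 - α) * scaledRadial α u s t = 0 ∧
      HasFDerivAt (fun x => P (logPolar x)) (pressureForm α (scaledRadial α u s t) (g₁ s t)
        (g₂ s t) (scaledAngular α u s t) (h₁ s t) (h₂ s t) s) (s, t) := by
  have hs' := Ioo_subset_Icc_self hs
  have ht' := Ioo_subset_Icc_self ht
  have hns := Icc_mem_nhds hs.1 hs.2
  have hnt := Icc_mem_nhds ht.1 ht.2
  have he : HasDerivAt (fun s => exp (-α * s)) (-α * exp (-α * s)) s := by
    simpa [mul_comm] using ((hasDerivAt_id s).const_mul (-α)).exp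
  have hU₁ := he.mul ((hg s hs' t ht').1.hasDerivAt hns)
  have hU₂ := ((hg s hs' t ht').2.hasDerivAt hnt).const_mul (exp (-α * s))
  have hV₁ := he.mul ((hh s hs' t ht').1.hasDerivAt hns)
  have hV₂ := ((hh s hs' t ht').2.hasDerivAt hnt).const_mul (exp (-α * s))
  have h := hE.polar hs ht
    (hU₁.congr_of_eventuallyEq (Eventually.of_forall fun s => radialComp_eq s t))
    (hU₂.congr_of_eventuallyEq (Eventually.of_forall fun t => radialComp_eq s t))
    (hV₁.congr_of_eventuallyEq (Eventually.of_forall fun s => angularComp_eq s t))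
    (hV₂.congr_of_eventuallyEq (Eventually.of_forall fun t => angularComp_eq s t))
  rw [radialComp_eq (α := α), angularComp_eq (α := α)] at h
  refine ⟨mul_left_cancel₀ (exp_pos (-α * s)).ne' ?_, ?_⟩
  · linear_combination h.1
  · have he2 : exp (-(2 * α) * s) = exp (-α * s) * exp (-α * s) := by
      rw [← exp_add]; congr 1; ring
    rw [pressureForm, he2]
    convert h.2 using 2 <;> ring

/-- The vorticity equation, in the interior, from the symmetry of the second derivatives of the
pressure. -/
lemma vorticity_eq_of_pressure (hθ₀ : 0 < θ₀) {p g g₁ g₂ g₁₁ g₁₂ g₂₂ h h₁ h₂ h₁₁ h₁₂ h₂₂ : ℝ → ℝ → ℝ}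
    {S : ℝ} (hS : 0 < S) (hg : C2Data S θ₀ g g₁ g₂ g₁₁ g₁₂ g₂₂)
    (hh : C2Data S θ₀ h h₁ h₂ h₁₁ h₁₂ h₂₂)
    (hdiv : ∀ s ∈ Icc 0 S, ∀ t ∈ Icc 0 θ₀, g₁ s t + h₂ s t + (1 - α) * g s t = 0)
    (hp : ∀ s ∈ Ioo 0 S, ∀ t ∈ Ioo 0 θ₀, HasFDerivAt (fun x : ℝ × ℝ => p x.1 x.2)
      (pressureForm α (g s t) (g₁ s t) (g₂ s t) (h s t) (h₁ s t) (h₂ s t) s) (s, t)) {s t : ℝ}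
    (hs : s ∈ Ioo 0 S) (ht : t ∈ Ioo 0 θ₀) :
    g s t * ((1 - α) * h₁ s t + h₁₁ s t - g₁₂ s t) +
        h s t * ((1 - α) * h₂ s t + h₁₂ s t - g₂₂ s t) =
      (α + 1) * g s t * ((1 - α) * h s t + h₁ s t - g₂ s t) := by
  have hexp : ∀ s, HasDerivAt (fun s => exp (-(2 * α) * s)) (-(2 * α) * exp (-(2 * α) * s)) s :=
    fun s => by simpa [mul_comm] using ((hasDerivAt_id s).const_mul (-(2 * α))).exp
  have he := hasPartials_of_deriv (S := S) (T := θ₀) hexp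
  have hec : ContDiffOn ℝ 1 (fun x : ℝ × ℝ => exp (-(2 * α) * x.1)) (rect S θ₀) :=
    ContDiff.contDiffOn (by fun_prop)
  have cg := hg.contDiffOn.of_le (m := 1) (by norm_num)
  have ch := hh.contDiffOn.of_le (m := 1) (by norm_num)
  -- The pressure is only assumed differentiable, but its differential is `C¹` by the momentum
  -- equation.
  have key := mixed_partials_eq hS hθ₀ (p := p)
    (hec.mul (((cg.mul (hg.contDiffOn₁.sub (contDiffOn_const.mul cg))).add
      (ch.mul hg.contDiffOn₂)).sub (ch.mul ch))).neg
    (hec.mul ((cg.mul (hh.contDiffOn₁.sub (contDiffOn_const.mul ch))).add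
      (ch.mul (hh.contDiffOn₂.add cg)))).neg
    (he.mul (((hg.partials.mul (hg.partials₁.sub (hg.partials.const_mul α))).add
      (hh.partials.mul hg.partials₂)).sub (hh.partials.mul hh.partials))).neg
    (he.mul ((hg.partials.mul (hh.partials₁.sub (hh.partials.const_mul α))).add
      (hh.partials.mul (hh.partials₂.add hg.partials)))).neg
    (fun x hx => by
      have := hp x.1 hx.1 x.2 hx.2
      rw [pressureForm] at this
      convert this using 4
      ring) hs ht
  have hd := hdiv s (Ioo_subset_Icc_self hs) t (Ioo_subset_Icc_self ht)
  refine mul_left_cancel₀ (exp_pos (-(2 * α) * s)).ne' ?_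
  -- The curl of the momentum equation contains vorticity times divergence, which is removed here.
  linear_combination key - exp (-(2 * α) * s) * (h₁ s t - g₂ s t + (1 - α) * h s t) * hd

/-- A solution of the boundary value problem gives a flow in logarithmic polar coordinates. -/
theorem exists_logPolarFlow (hα : α ≠ 1) (hθ₀ : 0 < θ₀)
    (hu : ContDiffOn ℝ 2 u (closure (sector 1 2 θ₀)))
    (hE : IsEulerSolution (sector 1 2 θ₀) u P)
    (hur : ∀ r ∈ Icc (1 : ℝ) 2, ∀ θ ∈ Icc (0 : ℝ) θ₀, 0 < |radialComp u r θ|)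
    (hedge : EdgeCondition α θ₀ c₁ c₂ u) (harc : ArcCondition α θ₀ u) :
    ∃ F : LogPolarFlow α (log 2) θ₀ c₁ c₂, F.g = scaledRadial α u ∧ F.h = scaledAngular α u := by
  have hS : 0 < log 2 := log_pos one_lt_two
  obtain ⟨g₁, g₂, g₁₁, g₁₂, g₂₂, hg⟩ :=
    ContDiffOn.exists_c2Data hS hθ₀ (contDiffOn_scaledRadial (α := α) hθ₀ hu)
  obtain ⟨h₁, h₂, h₁₁, h₁₂, h₂₂, hh⟩ :=
    ContDiffOn.exists_c2Data hS hθ₀ (contDiffOn_scaledAngular (α := α) hθ₀ hu)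
  have h0S : (0 : ℝ) ∈ Icc 0 (log 2) := left_mem_Icc.2 hS.le
  have hSS : log 2 ∈ Icc 0 (log 2) := right_mem_Icc.2 hS.le
  have hdiv : ∀ s ∈ Icc 0 (log 2), ∀ t ∈ Icc 0 θ₀,
      g₁ s t + h₂ s t + (1 - α) * scaledRadial α u s t = 0 := fun s hs t ht =>
    eqOn_rect_of_interior hS hθ₀ (B := fun _ => 0)
      ((hg.contDiffOn₁.continuousOn.add hh.contDiffOn₂.continuousOn).add
        (hg.contDiffOn.continuousOn.const_mul (1 - α))) continuousOn_const
      (fun s hs t ht => (hE.scaled hg.partials hh.partials hs ht).1) hs ht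
  have hedge' : ∀ {τ c : ℝ}, (∀ r ∈ Icc (1 : ℝ) 2, angularComp u r τ = c / r ^ α) →
      ∀ s ∈ Icc 0 (log 2), scaledAngular α u s τ = c := by
    intro τ c h s hs
    rw [scaledAngular, h _ (exp_mem_Icc hs), exp_mul_eq_rpow,
      mul_div_cancel₀ _ (rpow_pos_of_pos (exp_pos s) α).ne']
  refine ⟨{ g := scaledRadial α u, g₁ := g₁, g₂ := g₂, g₁₁ := g₁₁, g₁₂ := g₁₂, g₂₂ := g₂₂,
            h := scaledAngular α u, h₁ := h₁, h₂ := h₂, h₁₁ := h₁₁, h₁₂ := h₁₂, h₂₂ := h₂₂,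
            S_pos := hS, T_pos := hθ₀, α_ne := hα, g_data := hg, h_data := hh,
            g_ne := fun s hs t ht => mul_ne_zero (exp_pos _).ne'
              (abs_pos.1 (hur _ (exp_mem_Icc hs) t ht))
            div_eq := hdiv
            vorticity_eq := fun s hs t ht => ?_
            g_per := fun t ht => (harc.components ht).1
            h_per := fun t ht => (harc.components ht).2
            h₁_per := fun t ht => harc.deriv_eq ht (hh.partials 0 h0S t ht).1
              (hh.partials _ hSS t ht).1
            h_bot := hedge' fun r hr => (hedge r hr).1
            h_top := hedge' fun r hr => (hedge r hr).2 }, rfl, rfl⟩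
  have cg := hg.contDiffOn.continuousOn
  have ch := hh.contDiffOn.continuousOn
  have ch1 := hh.contDiffOn₁.continuousOn
  have ch2 := hh.contDiffOn₂.continuousOn
  have cg2 := hg.contDiffOn₂.continuousOn
  -- The Euler equations hold only in the open sector; the identity reaches the edges by continuity
  -- of the second derivatives.
  exact eqOn_rect_of_interior hS hθ₀
    ((cg.mul (((ch1.const_mul (1 - α)).add hh.continuousOn₁₁).sub hg.continuousOn₁₂)).add
      (ch.mul (((ch2.const_mul (1 - α)).add hh.continuousOn₁₂).sub hg.continuousOn₂₂)))
    ((cg.const_mul (α + 1)).mul (((ch.const_mul (1 - α)).add ch1).sub cg2))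
    (fun s hs t ht => vorticity_eq_of_pressure (p := fun s t => P (logPolar (s, t))) hθ₀ hS hg hh hdiv
      (fun s hs t ht => (hE.scaled hg.partials hh.partials hs ht).2) hs ht) hs ht

lemma ConstAngularDerivOnEdge.constOnEdge (hθ₀ : 0 < θ₀) (F : LogPolarFlow α (log 2) θ₀ c₁ c₂)
    (hFg : F.g = scaledRadial α u) {τ : ℝ} (hτ : τ ∈ Icc 0 θ₀)
    (h : ConstAngularDerivOnEdge α θ₀ u τ) : F.ConstOnEdge τ := by
  obtain ⟨c, hc⟩ := h
  refine ⟨c, fun s hs => ?_⟩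
  have h1 := (F.g_data.partials s hs τ hτ).2
  rw [← hc _ (exp_mem_Icc hs), ← h1.derivWithin (uniqueDiffOn_Icc hθ₀ τ hτ), hFg]
  simp only [scaledRadial, exp_mul_eq_rpow]

end Flow

/-! ### Pressure, homogeneity and the angular profiles -/

lemma eq_of_hasDerivAt_zero_Ioo {f : ℝ → ℝ} {a b : ℝ} (h : ∀ x ∈ Ioo a b, HasDerivAt f 0 x)
    {x y : ℝ} (hx : x ∈ Ioo a b) (hy : y ∈ Ioo a b) : f x = f y :=
  isOpen_Ioo.is_const_of_deriv_eq_zero isPreconnected_Ioo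
    (fun z hz => (h z hz).differentiableAt.differentiableWithinAt) (fun z hz => (h z hz).deriv) hx hy

lemma HasFDerivAt.partials {p : ℝ × ℝ → ℝ} {a b s t : ℝ}
    (h : HasFDerivAt p (oneForm a b) (s, t)) :
    HasDerivAt (fun s => p (s, t)) a s ∧ HasDerivAt (fun t => p (s, t)) b t := by
  constructor
  · exact (h.comp_hasDerivAt (f := fun s => (s, t)) s
      ((hasDerivAt_id s).prodMk (hasDerivAt_const s t))).congr_deriv (by simp)
  · exact (h.comp_hasDerivAt (f := fun t => (s, t)) t
      ((hasDerivAt_const t s).prodMk (hasDerivAt_id t))).congr_deriv (by simp)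

/-- A function whose differential is `e(s) Γ(t) ds`. -/
lemma exists_const_of_oneForm {S T : ℝ} (hS : 0 < S) (hT : 0 < T) {p : ℝ × ℝ → ℝ} {e Γ : ℝ → ℝ}
    (he : ∀ s, e s ≠ 0)
    (hp : ∀ s ∈ Ioo 0 S, ∀ t ∈ Ioo 0 T, HasFDerivAt p (oneForm (e s * Γ t) 0) (s, t)) :
    ∃ Γ₀, (∀ t ∈ Ioo 0 T, Γ t = Γ₀) ∧ ∀ q : ℝ → ℝ, (∀ s, HasDerivAt q (e s * Γ₀) s) →
      ∃ C, ∀ s ∈ Ioo 0 S, ∀ t ∈ Ioo 0 T, p (s, t) = q s + C := by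
  have hs₀ : S / 2 ∈ Ioo 0 S := ⟨by linarith, by linarith⟩
  have ht₀ : T / 2 ∈ Ioo 0 T := ⟨by linarith, by linarith⟩
  have h1 : ∀ s ∈ Ioo 0 S, ∀ t ∈ Ioo 0 T, p (s, t) = p (s, T / 2) := fun s hs t ht =>
    eq_of_hasDerivAt_zero_Ioo (f := fun t => p (s, t))
      (fun t ht => (hp s hs t ht).partials.2) ht ht₀
  refine ⟨Γ (T / 2), fun t ht => ?_, fun q hq => ⟨p (S / 2, T / 2) - q (S / 2), ?_⟩⟩
  -- Since `p` does not depend on `t`, neither does its `s`-derivative `e(s) Γ(t)`.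
  · have h2 := (hp _ hs₀ t ht).partials.1
    have h3 := (hp _ hs₀ _ ht₀).partials.1.congr_of_eventuallyEq
      (f₁ := fun s => p (s, t)) (by
        filter_upwards [Ioo_mem_nhds hs₀.1 hs₀.2] with s hs using h1 s hs t ht)
    exact mul_left_cancel₀ (he _) (h2.unique h3)
  · intro s hs t ht
    have h4 := eq_of_hasDerivAt_zero_Ioo (f := fun s => p (s, T / 2) - q s)
      (fun s hs => ((hp s hs _ ht₀).partials.1.sub (hq s)).congr_deriv (sub_self _)) hs hs₀
    rw [h1 s hs t ht]
    linarith

/-- A field with a power law in `r` is homogeneous. -/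
lemma homogeneousOn_of_polar {E : Type*} [AddCommGroup E] [Module ℝ E] {F : Plane → E} {β θ₀ : ℝ}
    {A : Set Plane} {w : ℝ → E} (hθ₀' : θ₀ < 2 * π)
    (h : ∀ x ∈ A, ∃ r > 0, ∃ t ∈ Icc 0 θ₀, x = polarPt r t ∧ F x = r ^ β • w t) :
    HomogeneousOn F β A := by
  intro x hx k hk hkx
  obtain ⟨r, hr, t, ht, hxr, hF⟩ := h x hx
  obtain ⟨r', hr', t', ht', hxr', hF'⟩ := h _ hkx
  have h1 : polarPt (k * r) t = polarPt r' t' := by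
    rw [← hxr', hxr, polarPt, polarPt, mul_smul]
  obtain ⟨rfl, rfl⟩ := polarPt_injective hθ₀' (mul_pos hk hr) hr' ht ht' h1
  rw [hF', hF, smul_smul, mul_rpow hk.le hr.le]

lemma exists_mem_Ioo_of_isOpen {v : ℝ → ℝ} {a b x : ℝ} (hab : a < b)
    (hv : ContinuousOn v (Icc a b)) (hx : x ∈ Icc a b) {U : Set ℝ} (hU : IsOpen U)
    (hvx : v x ∈ U) : ∃ y ∈ Ioo a b, v y ∈ U := by
  have : (𝓝[Ioo a b] x).NeBot := by
    rw [← mem_closure_iff_nhdsWithin_neBot, closure_Ioo hab.ne]; exact hx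
  have h : ∀ᶠ y in 𝓝[Ioo a b] x, v y ∈ U :=
    ((hv x hx).mono Ioo_subset_Icc_self).eventually (hU.mem_nhds hvx)
  exact (eventually_mem_nhdsWithin.and h).exists

namespace LogPolarFlow

variable {α S T c₁ c₂ : ℝ} (F : LogPolarFlow α S T c₁ c₂)

/-- Under the additional conditions the derivatives in `s` vanish and those in `t` do not depend
on `s`. -/
lemma derivs_eq (hF : F.AdditionalConditions) {s t : ℝ} (hs : s ∈ Icc 0 S) (ht : t ∈ Icc 0 T) :
    F.g₁ s t = 0 ∧ F.h₁ s t = 0 ∧ F.g₂ s t = F.g₂ 0 t ∧ F.h₂ s t = F.h₂ 0 t := by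
  have hS := uniqueDiffOn_Icc F.S_pos s hs
  have hT := uniqueDiffOn_Icc F.T_pos t ht
  obtain ⟨a1, a2⟩ := F.g_data.partials s hs t ht
  obtain ⟨b1, b2⟩ := F.h_data.partials s hs t ht
  refine ⟨hS.eq_deriv _ a1 ?_, hS.eq_deriv _ b1 ?_, hT.eq_deriv _ a2 ?_, hT.eq_deriv _ b2 ?_⟩
  · exact (hasDerivWithinAt_const s _ (F.g 0 t)).congr (fun x hx => (F.eq_left hF hx ht).1)
      (F.eq_left hF hs ht).1
  · exact (hasDerivWithinAt_const s _ (F.h 0 t)).congr (fun x hx => (F.eq_left hF hx ht).2)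
      (F.eq_left hF hs ht).2
  · exact (F.g_data.partials 0 F.zero_mem_S t ht).2.congr (fun x hx => (F.eq_left hF hs hx).1)
      (F.eq_left hF hs ht).1
  · exact (F.h_data.partials 0 F.zero_mem_S t ht).2.congr (fun x hx => (F.eq_left hF hs hx).2)
      (F.eq_left hF hs ht).2

lemma profile_div (hF : F.AdditionalConditions) {t : ℝ} (ht : t ∈ Icc 0 T) :
    F.h₂ 0 t + (1 - α) * F.g 0 t = 0 := by
  have := F.div_eq 0 F.zero_mem_S t ht
  rwa [(F.derivs_eq hF F.zero_mem_S ht).1, zero_add] at this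

/-- The angular profile is strictly monotone. -/
lemma profile_strictMono_or_strictAnti (hF : F.AdditionalConditions) :
    StrictMonoOn (F.h 0) (Icc 0 T) ∨ StrictAntiOn (F.h 0) (Icc 0 T) := by
  have hd : ∀ t ∈ Icc 0 T, HasDerivWithinAt (F.h 0) ((α - 1) * F.g 0 t) (Icc 0 T) t :=
    fun t ht => (F.h_data.partials 0 F.zero_mem_S t ht).2.congr_deriv
      (by linear_combination F.profile_div hF ht)
  rcases F.g_pos_or_neg with hg | hg <;> rcases F.α_ne.lt_or_gt with hα | hα
  · exact Or.inr (strictAntiOn_Icc_of_hasDerivWithinAt_neg hd fun t ht =>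
      mul_neg_of_neg_of_pos (by linarith) (hg 0 F.zero_mem_S t ht))
  · exact Or.inl (strictMonoOn_Icc_of_hasDerivWithinAt_pos hd fun t ht =>
      mul_pos (by linarith) (hg 0 F.zero_mem_S t ht))
  · exact Or.inl (strictMonoOn_Icc_of_hasDerivWithinAt_pos hd fun t ht =>
      mul_pos_of_neg_of_neg (by linarith) (hg 0 F.zero_mem_S t ht))
  · exact Or.inr (strictAntiOn_Icc_of_hasDerivWithinAt_neg hd fun t ht =>
      mul_neg_of_pos_of_neg (by linarith) (hg 0 F.zero_mem_S t ht))

/-- Strict monotonicity puts interior values strictly between the edge values. -/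
lemma profile_mem_Ioo (hF : F.AdditionalConditions) {t : ℝ} (ht : t ∈ Ioo 0 T) :
    (c₁ < F.h 0 t ∧ F.h 0 t < c₂) ∨ (c₂ < F.h 0 t ∧ F.h 0 t < c₁) := by
  have h₀ := F.h_bot 0 F.zero_mem_S
  have h₁ := F.h_top 0 F.zero_mem_S
  have ht' := Ioo_subset_Icc_self ht
  rcases F.profile_strictMono_or_strictAnti hF with h | h
  · exact Or.inl ⟨h₀.symm.trans_lt (h F.zero_mem_T ht' ht.1), (h ht' F.T_mem_T ht.2).trans_eq h₁⟩
  · exact Or.inr ⟨h₁.symm.trans_lt (h ht' F.T_mem_T ht.2), (h F.zero_mem_T ht' ht.1).trans_eq h₀⟩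

end LogPolarFlow

/-! ### The main theorem -/

theorem theorem2 (α θ₀ c₁ c₂ : ℝ) (hα : α ≠ 1) (hθ₀ : 0 < θ₀) (hθ₀' : θ₀ < 2 * π)
    (u : Plane → Plane) (P : Plane → ℝ)
    (hu : ContDiffOn ℝ 2 u (closure (sector 1 2 θ₀)))
    (hE : IsEulerSolution (sector 1 2 θ₀) u P)
    (hur : ∀ r ∈ Icc (1 : ℝ) 2, ∀ θ ∈ Icc (0 : ℝ) θ₀, 0 < |radialComp u r θ|)
    (hedge : EdgeCondition α θ₀ c₁ c₂ u)
    (harc : ArcCondition α θ₀ u) :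
    c₁ ≠ c₂ ∧
    (CondA1 α θ₀ c₁ c₂ u ∨ CondA2 α θ₀ c₁ u ∨ CondA3 α θ₀ c₂ u ∨ CondA4 α θ₀ c₁ c₂ u →
      HomogeneousOn u (-α) (closure (sector 1 2 θ₀)) ∧
      ∃ v f : ℝ → ℝ,
        ContDiffOn ℝ 2 v (Icc 0 θ₀) ∧ ContDiffOn ℝ 2 f (Icc 0 θ₀) ∧
        (∀ r ∈ Icc (1 : ℝ) 2, ∀ θ ∈ Icc (0 : ℝ) θ₀,
          u (polarPt r θ) = (v θ / r ^ α) • eTheta θ + (f θ / r ^ α) • eR θ) ∧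
        (∀ θ ∈ Icc (0 : ℝ) θ₀, (1 - α) * f θ + derivWithin v (Icc 0 θ₀) θ = 0) ∧
        -- the pressure, for nonzero `α`
        (α ≠ 0 → ∃ p C : ℝ,
          HomogeneousOn (fun x => P x - C) (-2 * α) (sector 1 2 θ₀) ∧
          (∀ r ∈ Ioo (1 : ℝ) 2, ∀ θ ∈ Ioo (0 : ℝ) θ₀,
            P (polarPt r θ) = p / r ^ (2 * α) + C) ∧
          ∀ θ ∈ Icc (0 : ℝ) θ₀, v θ * derivWithin f (Icc 0 θ₀) θ =
            α * f θ ^ 2 + v θ ^ 2 + 2 * α * p) ∧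
        -- the pressure, for `α = 0`, where a logarithm can occur
        (α = 0 → ∃ κ C : ℝ,
          (∀ r ∈ Ioo (1 : ℝ) 2, ∀ θ ∈ Ioo (0 : ℝ) θ₀,
            P (polarPt r θ) = κ * Real.log r + C) ∧
          ∀ θ ∈ Icc (0 : ℝ) θ₀, v θ * derivWithin f (Icc 0 θ₀) θ = v θ ^ 2 - κ) ∧
        (StrictMonoOn v (Icc 0 θ₀) ∨ StrictAntiOn v (Icc 0 θ₀)) ∧
        (CondA1 α θ₀ c₁ c₂ u ∨ CondA2 α θ₀ c₁ u ∨ CondA3 α θ₀ c₂ u →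
          ∀ θ ∈ Ioo (0 : ℝ) θ₀, 0 < |v θ|) ∧
        (CondA4 α θ₀ c₁ c₂ u →
          (∃ θ ∈ Ioo (0 : ℝ) θ₀, v θ < 0) ∧ ∃ θ ∈ Ioo (0 : ℝ) θ₀, 0 < v θ) ∧
        ((∀ θ ∈ Icc (0 : ℝ) θ₀, 0 < f θ) ∨ ∀ θ ∈ Icc (0 : ℝ) θ₀, f θ < 0)) := by
  obtain ⟨F, hFg, hFh⟩ := exists_logPolarFlow hα hθ₀ hu hE hur hedge harc
  refine ⟨F.edge_constants_ne, fun hcond => ?_⟩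
  have hedge₀ : ConstAngularDerivOnEdge α θ₀ u 0 → F.ConstOnEdge 0 := fun h =>
    h.constOnEdge hθ₀ F hFg F.zero_mem_T
  have hedge₁ : ConstAngularDerivOnEdge α θ₀ u θ₀ → F.ConstOnEdge θ₀ := fun h =>
    h.constOnEdge hθ₀ F hFg F.T_mem_T
  have hF : F.AdditionalConditions :=
    hcond.imp (fun h => ⟨h.1, h.2.imp hedge₀ hedge₁⟩) fun h =>
      h.imp (fun h => ⟨h.1, h.2.1, hedge₁ h.2.2⟩) fun h =>
        h.imp (fun h => ⟨h.1, h.2.1, hedge₀ h.2.2⟩) fun h =>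
          ⟨h.1, h.2.1, hedge₀ h.2.2.1, hedge₁ h.2.2.2⟩
  set v : ℝ → ℝ := F.h 0
  set f : ℝ → ℝ := F.g 0
  have hU := uniqueDiffOn_Icc hθ₀
  have hv' : ∀ θ ∈ Icc 0 θ₀, derivWithin v (Icc 0 θ₀) θ = F.h₂ 0 θ := fun θ hθ =>
    (F.h_data.partials 0 F.zero_mem_S θ hθ).2.derivWithin (hU θ hθ)
  have hf' : ∀ θ ∈ Icc 0 θ₀, derivWithin f (Icc 0 θ₀) θ = F.g₂ 0 θ := fun θ hθ =>
    (F.g_data.partials 0 F.zero_mem_S θ hθ).2.derivWithin (hU θ hθ)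
  have hslice : ContDiffOn ℝ 2 (fun θ : ℝ => ((0 : ℝ), θ)) (Icc 0 θ₀) :=
    ContDiff.contDiffOn (by fun_prop)
  have hmaps : MapsTo (fun θ : ℝ => ((0 : ℝ), θ)) (Icc 0 θ₀) (rect (log 2) θ₀) :=
    fun θ hθ => ⟨F.zero_mem_S, hθ⟩
  have hvC : ContDiffOn ℝ 2 v (Icc 0 θ₀) := F.h_data.contDiffOn.comp hslice hmaps
  have hfC : ContDiffOn ℝ 2 f (Icc 0 θ₀) := F.g_data.contDiffOn.comp hslice hmaps
  have hrep : ∀ r ∈ Icc (1 : ℝ) 2, ∀ θ ∈ Icc (0 : ℝ) θ₀,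
      u (polarPt r θ) = (v θ / r ^ α) • eTheta θ + (f θ / r ^ α) • eR θ := by
    intro r hr θ hθ
    have hr0 : 0 < r := zero_lt_one.trans_le hr.1
    obtain ⟨h1, h2⟩ := F.eq_left hF (log_mem_Icc hr) hθ
    rw [hFg, scaledRadial, exp_mul_eq_rpow, exp_log hr0, ← hFg] at h1
    rw [hFh, scaledAngular, exp_mul_eq_rpow, exp_log hr0, ← hFh] at h2
    have hra := (rpow_pos_of_pos hr0 α).ne'
    rw [eq_polar_components (u (polarPt r θ)) θ, add_comm]
    congr 2
    · rw [eq_div_iff hra, mul_comm]; exact h2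
    · rw [eq_div_iff hra, mul_comm]; exact h1
  -- With no dependence on `s`, the `dt` component of the pressure form is a multiple of `(1-α) f +
  -- v'`, which vanishes.
  obtain ⟨Γ₀, hΓ, hP⟩ := exists_const_of_oneForm (p := fun x => P (logPolar x))
    (e := fun s => exp (-(2 * α) * s))
    (Γ := fun t => α * f t ^ 2 + v t ^ 2 - v t * F.g₂ 0 t) F.S_pos hθ₀ (fun s => (exp_pos _).ne')
    (fun s hs t ht => by
      have hs' := Ioo_subset_Icc_self hs
      have ht' := Ioo_subset_Icc_self ht
      have h := (hE.scaled (hFg ▸ F.g_data.partials) (hFh ▸ F.h_data.partials) hs ht).2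
      obtain ⟨e1, e2, e3, e4⟩ := F.derivs_eq hF hs' ht'
      rw [← hFg, ← hFh, (F.eq_left hF hs' ht').1, (F.eq_left hF hs' ht').2, e1, e2, e3, e4,
        pressureForm] at h
      convert h using 2
      · ring
      · linear_combination exp (-(2 * α) * s) * v t * F.profile_div hF ht')
  have hΓ' : ∀ θ ∈ Icc 0 θ₀, v θ * derivWithin f (Icc 0 θ₀) θ = α * f θ ^ 2 + v θ ^ 2 - Γ₀ := by
    have hc : ContinuousOn (fun t => α * f t ^ 2 + v t ^ 2 - v t * F.g₂ 0 t) (Icc 0 θ₀) :=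
      ((continuousOn_const.mul (hfC.continuousOn.pow 2)).add (hvC.continuousOn.pow 2)).sub
        (hvC.continuousOn.mul (F.g_data.contDiffOn₂.continuousOn.comp hslice.continuousOn hmaps))
    have h : EqOn (fun t => α * f t ^ 2 + v t ^ 2 - v t * F.g₂ 0 t) (fun _ => Γ₀) (Ioo 0 θ₀) := hΓ
    intro θ hθ
    have h1 := h.of_subset_closure hc continuousOn_const Ioo_subset_Icc_self
      (closure_Ioo hθ₀.ne).ge hθ
    rw [hf' θ hθ]
    linear_combination -h1
  have hPr : ∀ {q : ℝ → ℝ}, (∀ s, HasDerivAt q (exp (-(2 * α) * s) * Γ₀) s) →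
      ∃ C, ∀ r ∈ Ioo (1 : ℝ) 2, ∀ θ ∈ Ioo (0 : ℝ) θ₀, P (polarPt r θ) = q (log r) + C := by
    intro q hq
    obtain ⟨C, hC⟩ := hP q hq
    refine ⟨C, fun r hr θ hθ => ?_⟩
    have hr0 : 0 < r := zero_lt_one.trans hr.1
    have := hC (log r) ⟨log_pos hr.1, log_lt_log hr0 hr.2⟩ θ hθ
    simpa [logPolar, exp_log hr0] using this
  refine ⟨?_, v, f, hvC, hfC, hrep, ?_, ?_, ?_, F.profile_strictMono_or_strictAnti hF, ?_, ?_, ?_⟩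
  · refine homogeneousOn_of_polar (w := fun θ => v θ • eTheta θ + f θ • eR θ) hθ₀' fun x hx => ?_
    obtain ⟨r, hr, θ, hθ, rfl⟩ := exists_polar_of_mem_closure hx
    have hr0 : 0 < r := zero_lt_one.trans_le hr.1
    refine ⟨r, hr0, θ, hθ, rfl, ?_⟩
    rw [hrep r hr θ hθ, rpow_neg hr0.le, smul_add, smul_smul, smul_smul, div_eq_inv_mul,
      div_eq_inv_mul]
  · intro θ hθ
    rw [hv' θ hθ, add_comm]
    exact F.profile_div hF hθ
  · intro hα0
    -- A primitive of `exp(-2αs) Γ₀`, so `p = -Γ₀ / (2α)`; for `α = 0` the primitive is `Γ₀ s = Γ₀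
    -- log r`.
    obtain ⟨C, hC⟩ := hPr (q := fun s => -Γ₀ / (2 * α) * exp (-(2 * α) * s)) fun s => by
      have h : HasDerivAt (fun s => exp (-(2 * α) * s))
          (exp (-(2 * α) * s) * (-(2 * α) * 1)) s := ((hasDerivAt_id s).const_mul _).exp
      refine (h.const_mul (-Γ₀ / (2 * α))).congr_deriv ?_
      field_simp
    have hC' : ∀ r ∈ Ioo (1 : ℝ) 2, ∀ θ ∈ Ioo (0 : ℝ) θ₀,
        P (polarPt r θ) = -Γ₀ / (2 * α) / r ^ (2 * α) + C := fun r hr θ hθ => by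
      have hr0 : 0 < r := zero_lt_one.trans hr.1
      rw [hC r hr θ hθ, exp_mul_eq_rpow, exp_log hr0, rpow_neg hr0.le, ← div_eq_mul_inv]
    refine ⟨-Γ₀ / (2 * α), C, ?_, hC', fun θ hθ => ?_⟩
    · refine homogeneousOn_of_polar (w := fun _ => -Γ₀ / (2 * α)) hθ₀' fun x hx => ?_
      obtain ⟨r, θ, h1, h2, h3, h4, rfl⟩ := hx
      have hr0 : 0 < r := zero_lt_one.trans h1
      refine ⟨r, hr0, θ, ⟨h3.le, h4.le⟩, rfl, ?_⟩
      rw [hC' r ⟨h1, h2⟩ θ ⟨h3, h4⟩, add_sub_cancel_right, neg_mul, rpow_neg hr0.le, smul_eq_mul,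
        div_eq_inv_mul _ (r ^ (2 * α))]
    · rw [hΓ' θ hθ]
      field_simp
      ring
  · rintro rfl
    obtain ⟨C, hC⟩ := hPr (q := fun s => Γ₀ * s) fun s => by
      simpa using (hasDerivAt_id s).const_mul Γ₀
    exact ⟨Γ₀, C, hC, fun θ hθ => by rw [hΓ' θ hθ]; ring⟩
  · intro h θ hθ
    rw [abs_pos]
    intro h0
    have hm := F.profile_mem_Ioo hF hθ
    change (c₁ < v θ ∧ v θ < c₂) ∨ (c₂ < v θ ∧ v θ < c₁) at hm
    rw [h0] at hm
    rcases h with h | h | h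
    · rcases hm with ⟨h1, h2⟩ | ⟨h1, h2⟩
      · exact (mul_neg_of_neg_of_pos h1 h2).not_gt h.1
      · exact (mul_neg_of_pos_of_neg h2 h1).not_gt h.1
    · have := h.1
      rcases hm with ⟨h1, h2⟩ | ⟨h1, h2⟩ <;> linarith
    · have := h.1
      rcases hm with ⟨h1, h2⟩ | ⟨h1, h2⟩ <;> linarith
  · intro h
    have h1 : v 0 = c₁ := F.h_bot 0 F.zero_mem_S
    have h2 : v θ₀ = c₂ := F.h_top 0 F.zero_mem_S
    -- The signs of `c₁` and `c₂` are attained at the endpoints; continuity carries them to nearby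
    -- interior angles.
    have key : ∀ {x : ℝ}, x ∈ Icc 0 θ₀ → ∀ {U : Set ℝ}, IsOpen U → v x ∈ U →
        ∃ y ∈ Ioo 0 θ₀, v y ∈ U := fun hx _ hU hvx =>
      exists_mem_Ioo_of_isOpen hθ₀ hvC.continuousOn hx hU hvx
    rcases mul_neg_iff.1 h.1 with ⟨h3, h4⟩ | ⟨h3, h4⟩
    · exact ⟨key F.T_mem_T isOpen_Iio (h2.trans_lt h4), key F.zero_mem_T isOpen_Ioi (h3.trans_eq h1.symm)⟩
    · exact ⟨key F.zero_mem_T isOpen_Iio (h1.trans_lt h3), key F.T_mem_T isOpen_Ioi (h4.trans_eq h2.symm)⟩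
  · exact F.g_pos_or_neg.imp (fun h => h 0 F.zero_mem_S) fun h => h 0 F.zero_mem_S
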